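/- Let $n$ sensors have gains $\alpha_i\neq 0$ and offsets $\beta_i$, $i=1,\dots,n$, so that the output of sensor $i$ is $y_i(t)=\alpha_i x(t)+\beta_i$, $t=0,1,2,\dots$. Let $\mathcal G$ be a digraph on $\{1,\dots,n\}$ with weights $\gamma_{ij}>0$ if there is an arc from $j$ to $i$ and $\gamma_{ij}=0$ otherwise, and let $\Gamma$ be the $n\times n$ matrix with entries $\gamma_{ij}$ for $i\ne j$ and $-\sum_{k\neq i}\gamma_{ik}$ on the diagonal. Put $$\Phi_i(t)=\begin{bmatrix}\alpha_i y_i(t)x(t) & \alpha_i y_i(t)\\ [1+\beta_i y_i(t)]x(t) & 1+\beta_i y_i(t)\end{bmatrix},\qquad B(t)=\mathrm{diag}\{\Phi_1(t),\dots,\Phi_n(t)\}(\Gamma\otimes I_2),\qquad \bar B=E\{B(t)\},$$ and consider, with a constant step $\delta>0$ and a deterministic initial vector $\hat\rho(0)\in\mathbb R^{2n}$ (in the calibration algorithm $\hat\rho(0)=[\alpha_1\ \beta_1\ \cdots\ \alpha_n\ \beta_n]^T$), the basic gradient calibration recursion $$\hat\rho(t+1)=[I+\delta B(t)]\hat\rho(t),\qquad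 \hat\rho(t)=[\hat g_1(t)\ \hat f_1(t)\ \cdots\ \hat g_n(t)\ \hat f_n(t)]^T,$$ where $\hat g_i$ and $\hat f_i$ are the equivalent gain and offset of sensor $i$. Assume that the random variables $x(t)$ are i.i.d. with $E\{x(t)^2\}<\infty$ and $\mathrm{var}\{x(t)\}>0$, and that $\mathcal G$ has a (directed, rooted) spanning tree. Let $i_1=[1\ 0\ 1\ 0\ \cdots\ 1\ 0]^T$ and $i_2=[0\ 1\ 0\ 1\ \cdots\ 0\ 1]^T$. Then there are unique row vectors $\pi_1,\pi_2$ with $\pi_1\bar B=\pi_2\bar B=0$ and $\begin{bmatrix}\pi_1\\ \pi_2\end{bmatrix}[\,i_1\ \ i_2\,]=I_2$, and there exists $\delta''>0$, not depending on $\hat\rho(0)$, such that for all $0<\delta\le\delta''$ and all $\hat\rho(0)$ $$\lim_{t\to\infty}\hat\rho(t)=(i_1\pi_1+i_2\pi_2)\,\hat\rho(0)$$ with probability one and, provided that $E\{x(t)^4\}<\infty$ (which makes $\hat\rho(t)$ square integrable), also in the mean square sense. In the limit vector all the gains are equal, and all the offsets are equal. -/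

import Mathlib

open MeasureTheory ProbabilityTheory Filter Topology
open scoped Kronecker Matrix

namespace BlindCalibration

/-- A digraph has a (directed, rooted) spanning tree: there are a root `r` and a sub-digraph `T`
on all the vertices such that no arc of `T` enters `r`, every other vertex is entered by exactly
one arc of `T`, and every vertex is reached from `r` by a walk in `T`.
`G.Adj u v` is an arc from `u` to `v`. -/
def HasSpanningTree {V : Type*} (G : Digraph V) : Prop :=
  ∃ (r : V) (T : Digraph V),
    (∀ u v, T.Adj u v → G.Adj u v) ∧
    (∀ u, ¬ T.Adj u r) ∧
    (∀ v, v ≠ r → ∃! u, T.Adj u v) ∧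
    ∀ v, Relation.ReflTransGen T.Adj r v

/-- The output of a sensor with gain `a` and offset `b` when the signal has the value `ξ`. -/
def sensorOutput (a b ξ : ℝ) : ℝ := a * ξ + b

/-- The `2 × 2` matrix `Φ_i(t)` of a sensor with gain `a` and offset `b`,
for the signal value `ξ = x(t)`. -/
def Phi (a b ξ : ℝ) : Matrix (Fin 2) (Fin 2) ℝ :=
  !![a * sensorOutput a b ξ * ξ, a * sensorOutput a b ξ;
     (1 + b * sensorOutput a b ξ) * ξ, 1 + b * sensorOutput a b ξ]

/-- The matrix `Γ`: off-diagonal entries `γ_{ij}`, diagonal entries `-∑_{j ≠ i} γ_{ij}`. -/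
def Gam {n : ℕ} (γ : Fin n → Fin n → ℝ) : Matrix (Fin n) (Fin n) ℝ :=
  Matrix.of fun i j => if i = j then -∑ k ∈ Finset.univ.erase i, γ i k else γ i j

/-- `diag{M_1, …, M_n}` with `2 × 2` blocks. A vector of `ℝ^{2n}` is indexed by
`Fin n × Fin 2`: first the sensor, then the component (`0` gain, `1` offset). -/
def blockDiag {n : ℕ} (M : Fin n → Matrix (Fin 2) (Fin 2) ℝ) :
    Matrix (Fin n × Fin 2) (Fin n × Fin 2) ℝ :=
  (Matrix.blockDiagonal M).submatrix Prod.swap Prod.swap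

/-- `B(t) = Φ(t) (Γ ⊗ I₂)` for the signal value `ξ = x(t)`. -/
def B {n : ℕ} (α β : Fin n → ℝ) (γ : Fin n → Fin n → ℝ) (ξ : ℝ) :
    Matrix (Fin n × Fin 2) (Fin n × Fin 2) ℝ :=
  blockDiag (fun i => Phi (α i) (β i) ξ) * (Gam γ ⊗ₖ (1 : Matrix (Fin 2) (Fin 2) ℝ))

/-- `B̄ = Φ̄ (Γ ⊗ I₂)`, where `Φ̄ = diag{E Φ_1, …, E Φ_n}` (entrywise expectation) for the random
signal value `X`. -/
noncomputable def Bbar {n : ℕ} {Ω : Type*} [MeasurableSpace Ω] (μ : Measure Ω)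
    (α β : Fin n → ℝ) (γ : Fin n → Fin n → ℝ) (X : Ω → ℝ) :
    Matrix (Fin n × Fin 2) (Fin n × Fin 2) ℝ :=
  blockDiag (fun i => Matrix.of fun k l => ∫ ω, Phi (α i) (β i) (X ω) k l ∂μ) *
    (Gam γ ⊗ₖ (1 : Matrix (Fin 2) (Fin 2) ℝ))

/-- The basic recursion `ρ̂(t+1) = [I + δ B(t)] ρ̂(t)`, started at `ρ₀`, along the signal path
`ξ = (x(0), x(1), …)`. -/
def rho {n : ℕ} (α β : Fin n → ℝ) (γ : Fin n → Fin n → ℝ) (δ : ℝ) (ρ₀ : Fin n × Fin 2 → ℝ)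
    (ξ : ℕ → ℝ) : ℕ → Fin n × Fin 2 → ℝ
  | 0 => ρ₀
  | t + 1 => (1 + δ • B α β γ (ξ t)) *ᵥ rho α β γ δ ρ₀ ξ t

/-- `i₁ = [1 0 1 0 … 1 0]ᵀ`. -/
def i₁ (n : ℕ) : Fin n × Fin 2 → ℝ := fun p => if p.2 = 0 then 1 else 0

/-- `i₂ = [0 1 0 1 … 0 1]ᵀ`. -/
def i₂ (n : ℕ) : Fin n × Fin 2 → ℝ := fun p => if p.2 = 1 then 1 else 0

/-- `π₁`, `π₂` are left eigenvectors of `M` for the eigenvalue zero, normalized by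
`[π₁; π₂] [i₁ i₂] = I₂`. -/
def IsNormalizedLeftPair {n : ℕ} (M : Matrix (Fin n × Fin 2) (Fin n × Fin 2) ℝ)
    (π₁ π₂ : Fin n × Fin 2 → ℝ) : Prop :=
  π₁ ᵥ* M = 0 ∧ π₂ ᵥ* M = 0 ∧
    π₁ ⬝ᵥ i₁ n = 1 ∧ π₁ ⬝ᵥ i₂ n = 0 ∧ π₂ ⬝ᵥ i₁ n = 0 ∧ π₂ ⬝ᵥ i₂ n = 1

/-- Convergence in the mean square sense of random vectors `Y t` to the vector `L`: every
component of every `Y t` is square integrable and `E ‖Y t - L‖² → 0` (Euclidean norm). -/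
def TendstoInMeanSquare {Ω ι : Type*} [MeasurableSpace Ω] [Fintype ι] (μ : Measure Ω)
    (Y : ℕ → Ω → ι → ℝ) (L : ι → ℝ) : Prop :=
  (∀ t p, MemLp (fun ω => Y t ω p) 2 μ) ∧
    Tendsto (fun t => ∫ ω, ∑ p, (Y t ω p - L p) ^ 2 ∂μ) atTop (𝓝 0)

end BlindCalibration

/-! Put `A_i = [α_i 0; β_i 1]` and let `S = [s m; m 1]` hold the moments `m = E x`, `s = E x²`. Then
the mean of `Φ_i` is `A_i A_iᵀ S`: a positive definite factor depending only on the sensor (since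
`α_i ≠ 0`), times a factor common to all sensors with determinant `s - m² = var x > 0`.

Three facts about the mean matrix follow by maximum principles on the digraph. Its kernel is spanned
by `i₁`, `i₂` (`meanB_ker`, the only one that uses the spanning tree); its range meets that span
trivially (`meanB_range_inter`), which gives existence and uniqueness of `π₁`, `π₂`; and its nonzero
eigenvalues have negative real part (`meanB_eigenvector_eq_zero`). Because the sensor factor does
not involve the signal, `π₁` and `π₂` annihilate `B(ξ)` for every value `ξ`, not just in the mean
(`vecMul_meanB_eq_zero`).

With `P = i₁ π₁ + i₂ π₂` this gives `P B(ξ) = B(ξ) P = 0`, so `P ρ̂(t)` is conserved and the error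
`ρ̂(t) - P ρ̂(0)` evolves by the factors `1 + δ (B - P)` (`rho_eq`). The mean of `B - P` has only
eigenvalues with negative real part.

For such i.i.d. factors the `L^p` norms of the products are summable when `δ` is small
(`exists_step_tsum_eLpNorm_stepProd_ne_top`). Over a block of fixed length `m`, the law of large
numbers in `L^p` makes the product close to `1 + δ m E b`, which contracts an adapted norm;
independence multiplies the block estimates. Since `B` is quadratic in `x`, the case `p = 1` needs
only `E x² < ∞` and yields almost sure convergence, while `p = 2` needs `E x⁴ < ∞` and yields mean
square convergence. -/

namespace BlindCalibration

/-! ### Products of random factors: adapted norm, independence, first-order expansion in `L^p`. -/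

section RandomProducts

open scoped ENNReal

/-- The product `(1 + δ y (t - 1)) ⋯ (1 + δ y 0)`. -/
def stepProd {R : Type*} [Ring R] [Module ℝ R] (δ : ℝ) (y : ℕ → R) : ℕ → R
  | 0 => 1
  | t + 1 => (1 + δ • y t) * stepProd δ y t

lemma stepProd_add {R : Type*} [Ring R] [Module ℝ R] (δ : ℝ) (y : ℕ → R) (t m : ℕ) :
    stepProd δ y (t + m) = stepProd δ (fun k => y (t + k)) m * stepProd δ y t := by
  induction m with
  | zero => simp [stepProd]
  | succ m ih => rw [← add_assoc, stepProd, ih, stepProd, mul_assoc]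

/-- A norm adapted to an element with a small power: left multiplication by `T` contracts it. -/
lemma exists_contracted_norm {R : Type*} [NormedRing R] [NormedAlgebra ℝ R] [NormOneClass R]
    (T : R) {N : ℕ} (hN : 0 < N) (hT : ‖T ^ N‖ ≤ 1 / 2) :
    ∃ (ν : R → ℝ) (r K : ℝ), 0 < r ∧ r < 1 ∧ 0 < K ∧ Continuous ν ∧ (∀ X, ‖X‖ ≤ ν X) ∧
      (∀ X, ν X ≤ K * ‖X‖) ∧ (∀ X Y, ν (X + Y) ≤ ν X + ν Y) ∧
      (∀ (c : ℝ) X, ν (c • X) = |c| * ν X) ∧ ∀ X, ν (T * X) ≤ r * ν X := by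
  set r : ℝ := (1 / 2 : ℝ) ^ (1 / (N : ℝ)) with hr
  have hN' : (N : ℝ) ≠ 0 := by positivity
  have hr0 : 0 < r := by positivity
  have hr1 : r < 1 := Real.rpow_lt_one (by norm_num) (by norm_num) (by positivity)
  have hrN : r ^ N = 1 / 2 := by
    rw [hr, ← Real.rpow_natCast, ← Real.rpow_mul (by norm_num), one_div_mul_cancel hN',
      Real.rpow_one]
  obtain ⟨N, rfl⟩ : ∃ M, N = M + 1 := ⟨N - 1, by omega⟩
  -- The weights make multiplication by `T` a shift of the sum, up to the factor `r`; the choice `r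
  -- ^ N = 1 / 2` balances the term that enters against the term `‖X‖` that leaves.
  refine ⟨fun X => ∑ k ∈ Finset.range (N + 1), (r ^ k)⁻¹ * ‖T ^ k * X‖, r,
    ∑ k ∈ Finset.range (N + 1), (r ^ k)⁻¹ * ‖T ^ k‖, hr0, hr1, ?_, ?_, ?_, ?_, ?_, ?_, ?_⟩
  · rw [Finset.sum_range_succ']
    have : 0 ≤ ∑ k ∈ Finset.range N, (r ^ (k + 1))⁻¹ * ‖T ^ (k + 1)‖ := by positivity
    simp only [pow_zero, inv_one, norm_one, mul_one]
    linarith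
  · fun_prop
  · intro X
    simp only [Finset.sum_range_succ']
    have : 0 ≤ ∑ k ∈ Finset.range N, (r ^ (k + 1))⁻¹ * ‖T ^ (k + 1) * X‖ := by positivity
    simp only [pow_zero, inv_one, one_mul]
    linarith
  · intro X
    rw [Finset.sum_mul]
    refine Finset.sum_le_sum fun k _ => ?_
    rw [mul_assoc]
    gcongr
    exact norm_mul_le _ _
  · intro X Y
    rw [← Finset.sum_add_distrib]
    refine Finset.sum_le_sum fun k _ => ?_
    rw [← mul_add, mul_add]
    gcongr
    exact norm_add_le _ _
  · intro c X
    rw [Finset.mul_sum]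
    refine Finset.sum_congr rfl fun k _ => ?_
    rw [mul_smul_comm, norm_smul, Real.norm_eq_abs]
    ring
  · intro X
    have h1 : ∑ k ∈ Finset.range (N + 1), (r ^ k)⁻¹ * ‖T ^ k * (T * X)‖ =
        r * ∑ k ∈ Finset.range (N + 1), (r ^ (k + 1))⁻¹ * ‖T ^ (k + 1) * X‖ := by
      rw [Finset.mul_sum]
      refine Finset.sum_congr rfl fun k _ => ?_
      rw [pow_succ T, mul_assoc]
      field_simp
      ring
    have h2 : ∑ k ∈ Finset.range (N + 1), (r ^ (k + 1))⁻¹ * ‖T ^ (k + 1) * X‖ + ‖X‖ =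
        ∑ k ∈ Finset.range (N + 1), (r ^ k)⁻¹ * ‖T ^ k * X‖ + 2 * ‖T ^ (N + 1) * X‖ := by
      have h := Finset.sum_range_succ' (fun k => (r ^ k)⁻¹ * ‖T ^ k * X‖) (N + 1)
      rw [Finset.sum_range_succ] at h
      simp only [pow_zero, inv_one, one_mul, hrN] at h
      rw [← h]
      norm_num
    have h3 : ‖T ^ (N + 1) * X‖ ≤ 1 / 2 * ‖X‖ := (norm_mul_le _ _).trans (by gcongr)
    simp only [h1]
    exact mul_le_mul_of_nonneg_left (by linarith) hr0.le

/-- Higher order part of `(1 + c)^m` as a function of the step. -/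
lemma exists_one_add_mul_pow_le (c : ℝ) (m : ℕ) {ε : ℝ} (hε : 0 < ε) :
    ∃ d > 0, ∀ δ : ℝ, 0 < δ → δ ≤ d → (1 + δ * c) ^ m - 1 - m * (δ * c) ≤ ε * δ := by
  have h : HasDerivAt (fun δ : ℝ => (1 + δ * c) ^ m) (m * c) 0 := by
    convert! (((hasDerivAt_id (0 : ℝ)).mul_const c).const_add 1).pow m using 1
    simp
  have h2 := (hasDerivAt_iff_isLittleO.1 h).def hε
  obtain ⟨d, hd, hd'⟩ := Metric.eventually_nhds_iff.1 h2
  refine ⟨d / 2, by positivity, fun δ h0 h1 => ?_⟩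
  have h3 := hd' (y := δ) (by rw [Real.dist_eq, sub_zero, abs_of_pos h0]; linarith)
  simp only [zero_mul, add_zero, one_pow, sub_zero, smul_eq_mul, Real.norm_eq_abs,
    abs_of_pos h0] at h3
  have := (abs_le.1 h3).2
  linarith

variable {Ω : Type*} [MeasurableSpace Ω] {μ : Measure Ω}

/-- Independence replaces Hölder's inequality, so arbitrarily long products stay in `L^p` without
higher moments of the factors. -/
lemma eLpNorm_mul_of_indepFun {f g : Ω → ℝ} (hf : Measurable f) (hg : Measurable g)
    (h : IndepFun f g μ) {p : ℝ≥0∞} (h0 : p ≠ 0) (htop : p ≠ ∞) :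
    eLpNorm (fun ω => f ω * g ω) p μ = eLpNorm f p μ * eLpNorm g p μ := by
  simp only [eLpNorm_eq_lintegral_rpow_enorm_toReal h0 htop, enorm_mul]
  rw [← ENNReal.mul_rpow_of_nonneg _ _ (by positivity)]
  congr 1
  simp only [ENNReal.mul_rpow_of_nonneg _ _ ENNReal.toReal_nonneg]
  have hm : Measurable fun z : ℝ => ‖z‖ₑ ^ p.toReal := by fun_prop
  exact lintegral_mul_eq_lintegral_mul_lintegral_of_indepFun (hm.comp hf) (hm.comp hg)
    (h.comp hm hm)

variable {R : Type*} [NormedRing R] [NormedAlgebra ℝ R] [MeasurableSpace R] [BorelSpace R]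
  [SecondCountableTopology R]

lemma measurable_stepProd (δ : ℝ) (m : ℕ) : Measurable fun y : ℕ → R => stepProd δ y m := by
  induction m with
  | zero => exact measurable_const
  | succ m ih =>
    simp only [stepProd]
    exact (measurable_const.add ((measurable_pi_apply m).const_smul δ)).mul ih

/-- The product of the first `t` factors is independent of the later factors. -/
lemma indepFun_stepProd {b : ℕ → Ω → R} (hb : ∀ t, Measurable (b t)) (hind : iIndepFun b μ)
    (δ : ℝ) (t : ℕ) :
    IndepFun (fun ω k => b (t + k) ω) (fun ω => stepProd δ (fun k => b k ω) t) μ := by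
  have h := indep_iSup_of_disjoint (fun k => (hb k).comap_le) hind
    (S := Set.Ici t) (T := Set.Iio t) (by
      rw [Set.disjoint_left]; intro a h1 h2; exact absurd (Set.mem_Iio.1 h2) (not_lt.2 h1))
  refine (IndepFun_iff_Indep _ _ _).2 (indep_of_indep_of_le_left (indep_of_indep_of_le_right h ?_) ?_)
  · refine Measurable.comap_le ?_
    have key : ∀ s ≤ t, @Measurable Ω R (⨆ i ∈ Set.Iio t, MeasurableSpace.comap (b i) inferInstance) _
        (fun ω => stepProd δ (fun k => b k ω) s) := by
      intro s
      induction s with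
      | zero => intro _; exact measurable_const
      | succ s ih =>
        intro hs
        have h1 : @Measurable Ω R (⨆ i ∈ Set.Iio t, MeasurableSpace.comap (b i) inferInstance) _
            (b s) :=
          Measurable.mono (comap_measurable (b s))
            (le_iSup₂_of_le s (show s ∈ Set.Iio t from hs) le_rfl) le_rfl
        simp only [stepProd]
        exact (measurable_const.add (h1.const_smul δ)).mul (ih (by omega))
    exact key t le_rfl
  · refine Measurable.comap_le ?_
    refine (@measurable_pi_iff Ω ℕ (fun _ => R) (_) _ _).2 fun k => ?_
    exact Measurable.mono (comap_measurable (b (t + k)))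
      (le_iSup₂_of_le (t + k) (show t + k ∈ Set.Ici t from Nat.le_add_right _ _) le_rfl) le_rfl

lemma eLpNorm_smul_mul_le {b : ℕ → Ω → R} (hb : ∀ t, Measurable (b t)) (hind : iIndepFun b μ)
    (hid : ∀ t, IdentDistrib (b t) (b 0) μ μ) {p : ℝ≥0∞} (h0 : p ≠ 0) (htop : p ≠ ∞)
    {δ : ℝ} (hδ : 0 ≤ δ) (t : ℕ) {g : R → R} (hg : Measurable g) :
    eLpNorm (fun ω => δ • b t ω * g (stepProd δ (fun k => b k ω) t)) p μ ≤
      ENNReal.ofReal δ * eLpNorm (b 0) p μ *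
        eLpNorm (fun ω => g (stepProd δ (fun k => b k ω) t)) p μ := by
  have hm : Measurable fun ω => stepProd δ (fun k => b k ω) t :=
    (measurable_stepProd δ t).comp (measurable_pi_iff.2 hb)
  have hi : IndepFun (fun ω => ‖b t ω‖) (fun ω => ‖g (stepProd δ (fun k => b k ω) t)‖) μ :=
    (indepFun_stepProd hb hind δ t).comp (φ := fun y : ℕ → R => ‖y 0‖) (ψ := fun z => ‖g z‖)
      (measurable_pi_apply 0).norm hg.norm
  have h1 := eLpNorm_mul_of_indepFun (hb t).norm (show Measurable fun ω =>
    ‖g (stepProd δ (fun k => b k ω) t)‖ from (hg.comp hm).norm) hi h0 htop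
  rw [eLpNorm_norm, eLpNorm_norm, (hid t).eLpNorm_eq] at h1
  rw [mul_assoc, ← h1]
  have h2 := eLpNorm_const_smul δ (fun ω => ‖b t ω‖ * ‖g (stepProd δ (fun k => b k ω) t)‖) p μ
  rw [← Real.enorm_of_nonneg hδ, ← h2]
  refine eLpNorm_mono fun ω => ?_
  rw [smul_mul_assoc, norm_smul, Pi.smul_apply, norm_smul]
  gcongr
  simpa using norm_mul_le _ _

variable [IsProbabilityMeasure μ] [NormOneClass R]

lemma eLpNorm_stepProd_sub_one_le {b : ℕ → Ω → R} (hb : ∀ t, Measurable (b t))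
    (hind : iIndepFun b μ) (hid : ∀ t, IdentDistrib (b t) (b 0) μ μ) {p : ℝ≥0∞} (hp : 1 ≤ p)
    (htop : p ≠ ∞) {c : ℝ} (hc : 0 ≤ c) (hbc : eLpNorm (b 0) p μ ≤ ENNReal.ofReal c)
    {δ : ℝ} (hδ : 0 ≤ δ) (m : ℕ) :
    eLpNorm (fun ω => stepProd δ (fun k => b k ω) m - 1) p μ ≤
      ENNReal.ofReal ((1 + δ * c) ^ m - 1) := by
  have h0 : p ≠ 0 := (zero_lt_one.trans_le hp).ne'
  have hm : ∀ m, Measurable fun ω => stepProd δ (fun k => b k ω) m := fun m =>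
    (measurable_stepProd δ m).comp (measurable_pi_iff.2 hb)
  induction m with
  | zero => simp [stepProd]
  | succ m ih =>
    have hge : 1 ≤ (1 + δ * c) ^ m := one_le_pow₀ (by nlinarith [mul_nonneg hδ hc])
    have e : (fun ω => stepProd δ (fun k => b k ω) (m + 1) - 1) =
        (fun ω => stepProd δ (fun k => b k ω) m - 1) +
          fun ω => δ • b m ω * stepProd δ (fun k => b k ω) m := by
      funext ω
      simp only [stepProd, Pi.add_apply]
      noncomm_ring
    have h1 : eLpNorm (fun ω => stepProd δ (fun k => b k ω) m) p μ ≤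
        ENNReal.ofReal ((1 + δ * c) ^ m) := by
      have e2 : (fun ω => stepProd δ (fun k => b k ω) m) =
        (fun ω => stepProd δ (fun k => b k ω) m - 1) + fun _ => (1 : R) := by
        funext ω; simp
      rw [e2]
      refine (eLpNorm_add_le ((hm m).sub_const 1).aestronglyMeasurable
        aestronglyMeasurable_const hp).trans ?_
      rw [eLpNorm_const _ h0 (IsProbabilityMeasure.ne_zero μ)]
      simp only [enorm_one, measure_univ, ENNReal.one_rpow, mul_one]
      refine (add_le_add_left ih _).trans ?_
      rw [← ENNReal.ofReal_one, ← ENNReal.ofReal_add (by linarith) zero_le_one]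
      simp
    rw [e]
    refine (eLpNorm_add_le ((hm m).sub_const 1).aestronglyMeasurable
      (((hb m).const_smul δ).mul (hm m)).aestronglyMeasurable hp).trans ?_
    refine (add_le_add ih ((eLpNorm_smul_mul_le hb hind hid h0 htop hδ m
      (g := fun z => z) measurable_id).trans (mul_le_mul' (mul_le_mul' le_rfl hbc) h1))).trans ?_
    rw [← ENNReal.ofReal_mul hδ, ← ENNReal.ofReal_mul (by positivity),
      ← ENNReal.ofReal_add (by linarith) (by positivity)]
    refine ENNReal.ofReal_le_ofReal (le_of_eq (by ring))

/-- Passing from `m` to `m + 1` adds `δ b_m (stepProd_m - 1)` to the remainder. By independence its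
norm is at most `δ c ((1 + δ c) ^ m - 1)`, exactly the increment of the scalar bound. -/
lemma eLpNorm_stepProd_sub_one_sub_sum_le {b : ℕ → Ω → R} (hb : ∀ t, Measurable (b t))
    (hind : iIndepFun b μ) (hid : ∀ t, IdentDistrib (b t) (b 0) μ μ) {p : ℝ≥0∞} (hp : 1 ≤ p)
    (htop : p ≠ ∞) {c : ℝ} (hc : 0 ≤ c) (hbc : eLpNorm (b 0) p μ ≤ ENNReal.ofReal c)
    {δ : ℝ} (hδ : 0 ≤ δ) (m : ℕ) :
    eLpNorm (fun ω => stepProd δ (fun k => b k ω) m - 1 - δ • ∑ k ∈ Finset.range m, b k ω) p μ ≤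
      ENNReal.ofReal ((1 + δ * c) ^ m - 1 - m * (δ * c)) := by
  have h0 : p ≠ 0 := (zero_lt_one.trans_le hp).ne'
  have hm : ∀ m, Measurable fun ω => stepProd δ (fun k => b k ω) m := fun m =>
    (measurable_stepProd δ m).comp (measurable_pi_iff.2 hb)
  induction m with
  | zero => simp [stepProd]
  | succ m ih =>
    have hge : 1 + m * (δ * c) ≤ (1 + δ * c) ^ m :=
      one_add_mul_le_pow (by nlinarith [mul_nonneg hδ hc]) m
    have hge' : 0 ≤ m * (δ * c) := by positivity
    have e : (fun ω => stepProd δ (fun k => b k ω) (m + 1) - 1 -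
          δ • ∑ k ∈ Finset.range (m + 1), b k ω) =
        (fun ω => stepProd δ (fun k => b k ω) m - 1 - δ • ∑ k ∈ Finset.range m, b k ω) +
          fun ω => δ • b m ω * (stepProd δ (fun k => b k ω) m - 1) := by
      funext ω
      simp only [stepProd, Pi.add_apply, Finset.sum_range_succ, smul_add]
      noncomm_ring
    have hs : Measurable fun ω => ∑ k ∈ Finset.range m, b k ω :=
      Finset.measurable_fun_sum _ fun k _ => hb k
    rw [e]
    refine (eLpNorm_add_le (((hm m).sub_const 1).sub (hs.const_smul δ)).aestronglyMeasurable
      (((hb m).const_smul δ).mul ((hm m).sub_const 1)).aestronglyMeasurable hp).trans ?_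
    refine (add_le_add ih ((eLpNorm_smul_mul_le hb hind hid h0 htop hδ m
      (g := fun z => z - 1) (measurable_id.sub_const 1)).trans (mul_le_mul' (mul_le_mul' le_rfl hbc)
        (eLpNorm_stepProd_sub_one_le hb hind hid hp htop hc hbc hδ m)))).trans ?_
    rw [← ENNReal.ofReal_mul hδ, ← ENNReal.ofReal_mul (by positivity),
      ← ENNReal.ofReal_add (by linarith) (mul_nonneg (by positivity) (by linarith))]
    refine ENNReal.ofReal_le_ofReal (le_of_eq (by push_cast; ring))

end RandomProducts

/-! ### Summability of the `L^p` norms of the products. -/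

section RandomProducts

open scoped ENNReal

/-- A partial sum `S` satisfies `S ≤ A + q S`, with `A` the sum of the first `m` terms, hence `S ≤ A
/ (1 - q)`. -/
lemma tsum_ne_top_of_shift_le {a : ℕ → ℝ≥0∞} {m : ℕ} {q : ℝ≥0∞} (hq : q < 1)
    (ha : ∀ t, a t ≠ ∞) (h : ∀ t, a (t + m) ≤ q * a t) : ∑' t, a t ≠ ∞ := by
  set A := ∑ t ∈ Finset.range m, a t
  have hA : A ≠ ∞ := ENNReal.sum_ne_top.2 fun t _ => ha t
  have hq' : 1 - q ≠ 0 := (tsub_pos_of_lt hq).ne'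
  refine ne_top_of_le_ne_top (ENNReal.div_ne_top hA hq') (ENNReal.tsum_le_of_sum_range_le fun M => ?_)
  have hS : ∑ t ∈ Finset.range M, a t ≠ ∞ := ENNReal.sum_ne_top.2 fun t _ => ha t
  rw [ENNReal.le_div_iff_mul_le (Or.inl hq') (Or.inl (by simp)),
    ENNReal.mul_sub (fun _ _ => hS), mul_one, tsub_le_iff_right]
  calc ∑ t ∈ Finset.range M, a t ≤ ∑ t ∈ Finset.range (m + M), a t :=
        Finset.sum_le_sum_of_subset (Finset.range_mono (by omega))
    _ = A + ∑ t ∈ Finset.range M, a (t + m) := by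
        rw [Finset.sum_range_add]; simp only [add_comm, A]
    _ ≤ A + (∑ t ∈ Finset.range M, a t) * q := by
        rw [Finset.sum_mul]
        gcongr with t
        rw [mul_comm]
        exact h t

variable {Ω : Type*} [MeasurableSpace Ω] {μ : Measure Ω} [IsProbabilityMeasure μ]
  {R : Type*} [NormedRing R] [NormedAlgebra ℝ R] [NormOneClass R] [CompleteSpace R]
  [MeasurableSpace R] [BorelSpace R] [SecondCountableTopology R]

/-- Products of i.i.d. random factors `1 + δ b t` are summable in `L^p` for all small steps `δ`,
if the mean of `b` is stable. -/
theorem exists_step_tsum_eLpNorm_stepProd_ne_top {b : ℕ → Ω → R} (hb : ∀ t, Measurable (b t))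
    (hind : iIndepFun b μ) (hid : ∀ t, IdentDistrib (b t) (b 0) μ μ) {p : ℝ≥0∞} (hp : 1 ≤ p)
    (htop : p ≠ ∞) (hLp : MemLp (b 0) p μ) {s₀ : ℝ} (hs₀ : 0 < s₀) {N : ℕ} (hN : 0 < N)
    (hT : ‖(1 + s₀ • ∫ ω, b 0 ω ∂μ) ^ N‖ ≤ 1 / 2) :
    ∃ d > 0, ∀ δ : ℝ, 0 < δ → δ ≤ d →
      ∑' t, eLpNorm (fun ω => stepProd δ (fun k => b k ω) t) p μ ≠ ∞ := by
  have h0 : p ≠ 0 := (zero_lt_one.trans_le hp).ne'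
  set bm : R := ∫ ω, b 0 ω ∂μ with hbm
  set T : R := 1 + s₀ • bm with hTdef
  obtain ⟨ν, r, K, hr0, hr1, hK, hνc, hν1, hνK, hνadd, hνsmul, hνT⟩ :=
    exists_contracted_norm T hN hT
  have hν0 : ∀ X, 0 ≤ ν X := fun X => (norm_nonneg X).trans (hν1 X)
  set c₀ : ℝ := (1 - r) / s₀ with hc₀
  have hc₀0 : 0 < c₀ := div_pos (by linarith) hs₀
  set c : ℝ := (eLpNorm (b 0) p μ).toReal with hc
  have hc0 : 0 ≤ c := ENNReal.toReal_nonneg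
  have hbc : eLpNorm (b 0) p μ ≤ ENNReal.ofReal c := (ENNReal.ofReal_toReal hLp.2.ne).ge
  -- The block length is fixed before `δ`, by the strong law in `L^p`. A direct second-order
  -- estimate of a single factor would not do: the fluctuation of `b` is of the same order `δ` as
  -- the contraction, and only averaging makes it small.
  obtain ⟨m, hm0, hm⟩ : ∃ m : ℕ, 0 < m ∧
      eLpNorm (fun ω => (m : ℝ)⁻¹ • (∑ i ∈ Finset.range m, b i ω) - bm) p μ ≤
        ENNReal.ofReal (c₀ / (4 * K)) := by
    have h := strong_law_Lp hp htop b hLp (fun i j hij => hind.indepFun hij) hid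
    have h2 := h.eventually_le_const (u := ENNReal.ofReal (c₀ / (4 * K)))
      (ENNReal.ofReal_pos.2 (by positivity))
    exact ((eventually_gt_atTop 0).and h2).exists
  have hm0' : (0 : ℝ) < m := Nat.cast_pos.2 hm0
  obtain ⟨d₁, hd₁, hd₁'⟩ := exists_one_add_mul_pow_le c m
    (ε := m * c₀ / (4 * K)) (by positivity)
  -- The three bounds keep, in this order, the higher-order remainder small, `1 - δ m / s₀`
  -- nonnegative (so that a convex combination arises), and `1 - δ c₀ m` nonnegative.
  refine ⟨min d₁ (min (s₀ / m) (1 / (c₀ * m))), by positivity, fun δ hδ0 hδ => ?_⟩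
  have hδ1 : δ ≤ d₁ := hδ.trans (min_le_left _ _)
  have hδ2 : δ * m ≤ s₀ := (le_div_iff₀ hm0').1
    (hδ.trans ((min_le_right _ _).trans (min_le_left _ _)))
  have hδ3 : δ * (c₀ * m) ≤ 1 := (le_div_iff₀ (by positivity)).1
    (hδ.trans ((min_le_right _ _).trans (min_le_right _ _)))
  set U : (ℕ → R) → R := fun y => (m : ℝ)⁻¹ • (∑ i ∈ Finset.range m, y i) - bm with hU
  set Rm : (ℕ → R) → R := fun y => stepProd δ y m - 1 - δ • ∑ k ∈ Finset.range m, y k with hRm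
  set G : (ℕ → R) → ℝ := fun y =>
    (1 - δ * (c₀ * m)) + (δ * m * K) * ‖U y‖ + K * ‖Rm y‖ with hG
  have hsm : Measurable fun y : ℕ → R => ∑ k ∈ Finset.range m, y k :=
    Finset.measurable_fun_sum _ fun k _ => measurable_pi_apply k
  have hUm : Measurable U := (hsm.const_smul _).sub_const _
  have hRmm : Measurable Rm := ((measurable_stepProd δ m).sub_const _).sub (hsm.const_smul _)
  have hGm : Measurable G :=
    (measurable_const.add (hUm.norm.const_mul _)).add (hRmm.norm.const_mul _)
  have hbpi : Measurable fun ω (k : ℕ) => b k ω := measurable_pi_iff.2 hb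
  -- The contraction gains `δ c₀ m`; fluctuation and remainder each give back at most a quarter of
  -- it.
  have hGle : eLpNorm (fun ω => G fun k => b k ω) p μ ≤
      ENNReal.ofReal (1 - δ * (c₀ * m) / 2) := by
    have e1 : eLpNorm (fun _ : Ω => (1 - δ * (c₀ * m))) p μ ≤
        ENNReal.ofReal (1 - δ * (c₀ * m)) := by
      rw [eLpNorm_const _ h0 (IsProbabilityMeasure.ne_zero μ)]
      simp [Real.enorm_of_nonneg (sub_nonneg.2 hδ3)]
    have e2 : eLpNorm (fun ω => (δ * m * K) * ‖U fun k => b k ω‖) p μ ≤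
        ENNReal.ofReal (δ * m * K * (c₀ / (4 * K))) := by
      refine (eLpNorm_const_smul (δ * m * K) (fun ω => ‖U fun k => b k ω‖) p μ).le.trans ?_
      rw [eLpNorm_norm, Real.enorm_of_nonneg (by positivity),
        ENNReal.ofReal_mul (p := δ * m * K) (by positivity)]
      exact mul_le_mul' le_rfl hm
    have e3 : eLpNorm (fun ω => K * ‖Rm fun k => b k ω‖) p μ ≤
        ENNReal.ofReal (K * (m * c₀ / (4 * K) * δ)) := by
      refine (eLpNorm_const_smul K (fun ω => ‖Rm fun k => b k ω‖) p μ).le.trans ?_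
      rw [eLpNorm_norm, Real.enorm_of_nonneg hK.le, ENNReal.ofReal_mul hK.le]
      exact mul_le_mul' le_rfl ((eLpNorm_stepProd_sub_one_sub_sum_le hb hind hid hp htop hc0 hbc
        hδ0.le m).trans (ENNReal.ofReal_le_ofReal (hd₁' δ hδ0 hδ1)))
    have m2 : Measurable fun ω => (δ * m * K) * ‖U fun k => b k ω‖ :=
      (hUm.comp hbpi).norm.const_mul _
    have m3 : Measurable fun ω => K * ‖Rm fun k => b k ω‖ := (hRmm.comp hbpi).norm.const_mul _
    refine (eLpNorm_add_le (f := fun ω => (1 - δ * (c₀ * m)) + (δ * m * K) * ‖U fun k => b k ω‖)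
      (measurable_const.add m2).aestronglyMeasurable m3.aestronglyMeasurable hp).trans ?_
    refine (add_le_add ((eLpNorm_add_le (f := fun _ => (1 - δ * (c₀ * m)))
      aestronglyMeasurable_const m2.aestronglyMeasurable hp).trans (add_le_add e1 e2)) e3).trans ?_
    rw [← ENNReal.ofReal_add (by linarith) (by positivity),
      ← ENNReal.ofReal_add (add_nonneg (by linarith) (by positivity)) (by positivity)]
    refine ENNReal.ofReal_le_ofReal (le_of_eq ?_)
    field_simp
    ring
  have hstep : ∀ y X, ν (stepProd δ y m * X) ≤ G y * ν X := by
    intro y X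
    have hsum : δ • ∑ k ∈ Finset.range m, y k = (δ * m) • bm + (δ * m) • U y := by
      simp only [hU, smul_sub, smul_smul]
      rw [mul_assoc, mul_inv_cancel₀ hm0'.ne', mul_one]
      abel
    -- The mean part `1 + δ m bm` is the convex combination of `1` and `T = 1 + s₀ bm` with weight
    -- `δ m / s₀` on `T`. Its contraction factor for `ν` is therefore `1 - δ m (1 - r) / s₀ = 1 - δ
    -- c₀ m`.
    have hdec : stepProd δ y m * X = ((1 - δ * m / s₀) • X + (δ * m / s₀) • (T * X)) +
        (δ * m) • (U y * X) + Rm y * X := by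
      have h1 : stepProd δ y m = Rm y + 1 + ((δ * m) • bm + (δ * m) • U y) := by
        rw [← hsum]; simp only [hRm]; abel
      have h2 : (δ * m / s₀) • (T * X) = (δ * m / s₀) • X + (δ * m) • (bm * X) := by
        rw [hTdef, add_mul, one_mul, smul_add, smul_mul_assoc, smul_smul,
          div_mul_cancel₀ _ hs₀.ne']
      rw [h2, sub_smul, one_smul, h1]
      simp only [add_mul, one_mul, smul_mul_assoc]
      abel
    have hn : ∀ Y, ν (Y * X) ≤ K * ‖Y‖ * ν X := fun Y => by
      refine (hνK _).trans ?_
      rw [mul_assoc]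
      gcongr
      exact (norm_mul_le _ _).trans (mul_le_mul_of_nonneg_left (hν1 X) (norm_nonneg _))
    have h1 : ν ((1 - δ * m / s₀) • X) = (1 - δ * m / s₀) * ν X := by
      rw [hνsmul, abs_of_nonneg (sub_nonneg.2 ((div_le_one hs₀).2 hδ2))]
    have h2 : ν ((δ * m / s₀) • (T * X)) ≤ (δ * m / s₀) * (r * ν X) := by
      rw [hνsmul, abs_of_nonneg (by positivity)]
      gcongr
      exact hνT X
    have h3 : ν ((δ * m) • (U y * X)) ≤ (δ * m) * (K * ‖U y‖ * ν X) := by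
      rw [hνsmul, abs_of_nonneg (by positivity)]
      gcongr
      exact hn _
    have h4 := hn (Rm y)
    rw [hdec]
    have h5 := (hνadd ((1 - δ * m / s₀) • X + (δ * m / s₀) • (T * X) + (δ * m) • (U y * X))
      (Rm y * X)).trans (add_le_add_left (hνadd _ _) _)
    have h6 := hνadd ((1 - δ * m / s₀) • X) ((δ * m / s₀) • (T * X))
    have h7 : G y * ν X = (1 - δ * m / s₀) * ν X + (δ * m / s₀) * (r * ν X) +
        (δ * m) * (K * ‖U y‖ * ν X) + K * ‖Rm y‖ * ν X := by
      simp only [hG, hc₀]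
      field_simp
      ring
    rw [h7]
    linarith
  have hPm : ∀ t, Measurable fun ω => stepProd δ (fun k => b k ω) t := fun t =>
    (measurable_stepProd δ t).comp hbpi
  set a : ℕ → ℝ≥0∞ := fun t => eLpNorm (fun ω => ν (stepProd δ (fun k => b k ω) t)) p μ with ha
  have hPa : ∀ t, eLpNorm (fun ω => stepProd δ (fun k => b k ω) t) p μ ≤ a t := fun t =>
    eLpNorm_mono_real fun ω => hν1 _
  refine ne_top_of_le_ne_top ?_ (ENNReal.tsum_le_tsum hPa)
  refine tsum_ne_top_of_shift_le (m := m) (q := ENNReal.ofReal (1 - δ * (c₀ * m) / 2)) ?_ ?_ ?_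
  · rw [ENNReal.ofReal_lt_one]
    have : 0 < δ * (c₀ * m) := by positivity
    linarith
  · intro t
    have h1 : MemLp (fun ω => stepProd δ (fun k => b k ω) t - 1) p μ :=
      ⟨((hPm t).sub_const 1).aestronglyMeasurable,
        (eLpNorm_stepProd_sub_one_le hb hind hid hp htop hc0 hbc hδ0.le t).trans_lt
          ENNReal.ofReal_lt_top⟩
    have h2 : MemLp (fun ω => stepProd δ (fun k => b k ω) t) p μ := by
      convert! h1.add (memLp_const (1 : R)) using 1
      funext ω
      simp
    refine ((h2.norm.const_mul K).mono (hνc.measurable.comp (hPm t)).aestronglyMeasurable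
      (ae_of_all _ fun ω => ?_)).2.ne
    have := hνK (stepProd δ (fun k => b k ω) t)
    simp only [Function.comp_apply, Real.norm_eq_abs]
    rw [abs_of_nonneg (hν0 _)]
    exact this.trans (le_abs_self _)
  · intro t
    have hiG : IndepFun (fun ω => G fun k => b (t + k) ω)
        (fun ω => ν (stepProd δ (fun k => b k ω) t)) μ :=
      (indepFun_stepProd hb hind δ t).comp (φ := G) (ψ := ν) hGm hνc.measurable
    -- Stationarity: the whole shifted sequence has the law of the original one, so the block bound
    -- holds from any starting time.
    have hshift : IdentDistrib (fun ω k => b (t + k) ω) (fun ω k => b k ω) μ μ :=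
      IdentDistrib.pi (fun k => (hid (t + k)).trans (hid k).symm)
        (hind.precomp (add_right_injective t)) hind
    have hGs : eLpNorm (fun ω => G fun k => b (t + k) ω) p μ =
        eLpNorm (fun ω => G fun k => b k ω) p μ := (hshift.comp hGm).eLpNorm_eq p
    have hbs : Measurable fun ω (k : ℕ) => b (t + k) ω := measurable_pi_iff.2 fun k => hb _
    calc a (t + m) ≤ eLpNorm (fun ω => (G fun k => b (t + k) ω) *
            ν (stepProd δ (fun k => b k ω) t)) p μ := by
          refine eLpNorm_mono_real fun ω => ?_
          rw [Real.norm_eq_abs, abs_of_nonneg (hν0 _), stepProd_add]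
          exact hstep _ _
      _ ≤ _ := by
          rw [eLpNorm_mul_of_indepFun (f := fun ω => G fun k => b (t + k) ω)
            (g := fun ω => ν (stepProd δ (fun k => b k ω) t)) (hGm.comp hbs)
            (hνc.measurable.comp (hPm t)) hiG h0 htop, hGs]
          exact mul_le_mul' hGle le_rfl

end RandomProducts

/-! ### Maximum principles for the weighted digraph. -/

section Laplacian

variable {n : ℕ} {G : Digraph (Fin n)} {γ : Fin n → Fin n → ℝ}

/-- A loop weight `γ i i` is harmless: `Gam` ignores it and on the right it multiplies `f i - f i`.
The general `V` serves real vectors and complex eigenvectors alike. -/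
lemma Gam_sum_smul {V : Type*} [AddCommGroup V] [Module ℝ V] (γ : Fin n → Fin n → ℝ)
    (f : Fin n → V) (i : Fin n) :
    ∑ j, Gam γ i j • f j = ∑ j, γ i j • (f j - f i) := by
  rw [← Finset.add_sum_erase _ _ (Finset.mem_univ i),
    ← Finset.add_sum_erase _ (fun j => γ i j • (f j - f i)) (Finset.mem_univ i)]
  simp only [sub_self, smul_zero, zero_add, smul_sub, Finset.sum_sub_distrib, ← Finset.sum_smul]
  rw [Finset.sum_congr rfl (g := fun j => γ i j • f j) fun j hj => by
    simp [Gam, (Finset.ne_of_mem_erase hj).symm]]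
  simp only [Gam, Matrix.of_apply, if_true, neg_smul]
  abel

lemma weight_nonneg (hpos : ∀ i j, G.Adj j i → 0 < γ i j) (hzero : ∀ i j, ¬ G.Adj j i → γ i j = 0)
    (i j : Fin n) : 0 ≤ γ i j := by
  by_cases h : G.Adj j i
  · exact (hpos i j h).le
  · exact (hzero i j h).ge

/-- A function that is harmonic for the weighted digraph attains its maximum at every root. -/
lemma le_root_of_harmonic (hpos : ∀ i j, G.Adj j i → 0 < γ i j)
    (hzero : ∀ i j, ¬ G.Adj j i → γ i j = 0) {T : Digraph (Fin n)}
    (hTG : ∀ u v, T.Adj u v → G.Adj u v) {r : Fin n}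
    (hr : ∀ v, Relation.ReflTransGen T.Adj r v) {f : Fin n → ℝ}
    (hf : ∀ i, ∑ j, γ i j * (f j - f i) = 0) (i : Fin n) : f i ≤ f r := by
  have : Nonempty (Fin n) := ⟨r⟩
  obtain ⟨k, hk⟩ := Finite.exists_max f
  suffices h : f r = f k by rw [h]; exact hk i
  -- The walk from the root to a maximizer is followed backwards: at a maximizer the vanishing sum
  -- has only nonpositive terms, so every in-neighbour is again a maximizer.
  refine Relation.ReflTransGen.head_induction_on (motive := fun a _ => f a = f k) (hr k) rfl ?_
  intro a c hac _ hc
  have hle : ∀ j ∈ Finset.univ, γ c j * (f j - f c) ≤ 0 := fun j _ =>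
    mul_nonpos_of_nonneg_of_nonpos (weight_nonneg hpos hzero c j) (by rw [hc]; linarith [hk j])
  have h := (Finset.sum_eq_zero_iff_of_nonpos hle).1 (hf c) a (Finset.mem_univ a)
  rcases mul_eq_zero.1 h with h | h
  · exact absurd h (hpos c a (hTG a c hac)).ne'
  · linarith

lemma eq_of_harmonic (hpos : ∀ i j, G.Adj j i → 0 < γ i j)
    (hzero : ∀ i j, ¬ G.Adj j i → γ i j = 0) (hG : HasSpanningTree G) {f : Fin n → ℝ}
    (hf : ∀ i, ∑ j, γ i j * (f j - f i) = 0) (i j : Fin n) : f i = f j := by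
  obtain ⟨r, T, hTG, -, -, hr⟩ := hG
  have h1 := le_root_of_harmonic hpos hzero hTG hr hf
  have h2 := le_root_of_harmonic hpos hzero hTG hr (f := fun i => -f i) (fun i => by
    rw [← neg_eq_zero, ← Finset.sum_neg_distrib, ← hf i]
    exact Finset.sum_congr rfl fun j _ => by ring)
  have h : ∀ i, f i = f r := fun i => le_antisymm (h1 i) (by have := h2 i; linarith)
  rw [h i, h j]

lemma exists_sum_nonpos (hn : 0 < n) (hγ : ∀ i j, 0 ≤ γ i j) (f : Fin n → ℝ) :
    ∃ i, ∑ j, γ i j * (f j - f i) ≤ 0 := by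
  have : Nonempty (Fin n) := ⟨⟨0, hn⟩⟩
  obtain ⟨k, hk⟩ := Finite.exists_max f
  exact ⟨k, Finset.sum_nonpos fun j _ =>
    mul_nonpos_of_nonneg_of_nonpos (hγ k j) (by linarith [hk j])⟩

/-- Maximum principle for vector-valued consensus: the disagreement vectors cannot all make an
acute angle with the states. -/
lemma eq_zero_of_re_inner_nonneg {V : Type*} [NormedAddCommGroup V] [InnerProductSpace ℂ V]
    (hγ : ∀ i j, 0 ≤ γ i j) {u h : Fin n → V}
    (hh : ∀ i, h i = ∑ j, (γ i j : ℂ) • (u j - u i))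
    (hre : ∀ i, 0 ≤ (inner ℂ (u i) (h i)).re) (h0 : ∀ i, h i = 0 → u i = 0) (i : Fin n) :
    u i = 0 := by
  have : Nonempty (Fin n) := ⟨i⟩
  obtain ⟨k, hk⟩ := Finite.exists_max fun i => ‖u i‖
  set d : ℝ := ∑ j, γ k j with hd
  have hd0 : 0 ≤ d := Finset.sum_nonneg fun j _ => hγ k j
  have e : h k + (d : ℂ) • u k = ∑ j, (γ k j : ℂ) • u j := by
    rw [hh k, hd]
    simp only [smul_sub, Finset.sum_sub_distrib, ← Finset.sum_smul]
    push_cast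
    abel
  have hle : ‖h k + (d : ℂ) • u k‖ ≤ d * ‖u k‖ := by
    rw [e, hd, Finset.sum_mul]
    refine (norm_sum_le _ _).trans (Finset.sum_le_sum fun j _ => ?_)
    rw [norm_smul, Complex.norm_real, Real.norm_eq_abs, abs_of_nonneg (hγ k j)]
    exact mul_le_mul_of_nonneg_left (hk j) (hγ k j)
  -- At an index of maximal norm, `h k + d u k` is a weighted sum of the `u j`, hence no longer than
  -- `d ‖u k‖`. Expanding the square, the nonnegative cross term forces `h k = 0`.
  have hsq := norm_add_sq (𝕜 := ℂ) (h k) ((d : ℂ) • u k)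
  have hin : RCLike.re (inner ℂ (h k) ((d : ℂ) • u k)) = d * (inner ℂ (u k) (h k)).re := by
    rw [inner_smul_right, ← RCLike.ofReal_eq_complex_ofReal, RCLike.re_ofReal_mul, inner_re_symm]
    rfl
  rw [hin, norm_smul, Complex.norm_real, Real.norm_eq_abs, abs_of_nonneg hd0] at hsq
  have hsq' : ‖h k + (d : ℂ) • u k‖ ^ 2 ≤ (d * ‖u k‖) ^ 2 := by gcongr
  have hk0 : h k = 0 := by
    have := mul_nonneg hd0 (hre k)
    have h3 : ‖h k‖ ^ 2 ≤ 0 := by linarith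
    exact norm_eq_zero.1 (pow_eq_zero_iff two_ne_zero |>.1 (le_antisymm h3 (sq_nonneg _)))
  have hu := hk i
  rw [h0 k hk0, norm_zero] at hu
  exact norm_le_zero_iff.1 hu

end Laplacian

/-! ### Kernel, range and nonzero spectrum of the mean matrix. -/

section MeanMatrix

variable {n : ℕ} {G : Digraph (Fin n)} {γ : Fin n → Fin n → ℝ} {α β : Fin n → ℝ}

/-- The expectation of `Phi a b` for a signal with first moment `m` and second moment `s`. -/
def meanPhi (a b m s : ℝ) : Matrix (Fin 2) (Fin 2) ℝ :=
  !![a * (a * s + b * m), a * (a * m + b); m + b * (a * s + b * m), 1 + b * (a * m + b)]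

/-- The expectation of `B α β γ` for a signal with first moment `m` and second moment `s`. -/
def meanB (α β : Fin n → ℝ) (γ : Fin n → Fin n → ℝ) (m s : ℝ) :
    Matrix (Fin n × Fin 2) (Fin n × Fin 2) ℝ :=
  blockDiag (fun i => meanPhi (α i) (β i) m s) * (Gam γ ⊗ₖ (1 : Matrix (Fin 2) (Fin 2) ℝ))

/-- A fixed signal value is a signal with moments `ξ` and `ξ²`, so results about `meanB` for
arbitrary `m`, `s` apply also to the random matrix itself. -/
lemma Phi_eq_meanPhi (a b ξ : ℝ) : Phi a b ξ = meanPhi a b ξ (ξ ^ 2) := by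
  ext k l
  fin_cases k <;> fin_cases l <;> simp [Phi, meanPhi, sensorOutput] <;> ring

lemma B_eq_meanB (ξ : ℝ) : B α β γ ξ = meanB α β γ ξ (ξ ^ 2) := by
  simp only [B, meanB, Phi_eq_meanPhi]

lemma meanPhi_affine (a b m s : ℝ) : meanPhi a b m s = meanPhi a b 0 0 +
    m • (meanPhi a b 1 0 - meanPhi a b 0 0) + s • (meanPhi a b 0 1 - meanPhi a b 0 0) := by
  ext k l
  fin_cases k <;> fin_cases l <;> simp [meanPhi] <;> ring

lemma integral_Phi {Ω : Type*} [MeasurableSpace Ω] {μ : Measure Ω} [IsProbabilityMeasure μ]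
    {X : Ω → ℝ} (hX : MemLp X 2 μ) (a b : ℝ) :
    (Matrix.of fun k l => ∫ ω, Phi a b (X ω) k l ∂μ) =
      meanPhi a b (∫ ω, X ω ∂μ) (∫ ω, X ω ^ 2 ∂μ) := by
  have h1 : Integrable X μ := hX.integrable (by norm_num)
  have h2 : Integrable (fun ω => X ω ^ 2) μ := hX.integrable_sq
  ext k l
  have e : ∀ ω, Phi a b (X ω) k l = meanPhi a b 0 0 k l +
      X ω * (meanPhi a b 1 0 k l - meanPhi a b 0 0 k l) +
      X ω ^ 2 * (meanPhi a b 0 1 k l - meanPhi a b 0 0 k l) := fun ω => by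
    rw [Phi_eq_meanPhi, meanPhi_affine]; rfl
  rw [meanPhi_affine, Matrix.of_apply]
  simp only [e]
  have key : ∀ c₀ c₁ c₂ : ℝ, ∫ ω, (c₀ + X ω * c₁ + X ω ^ 2 * c₂) ∂μ =
      c₀ + (∫ ω, X ω ∂μ) * c₁ + (∫ ω, X ω ^ 2 ∂μ) * c₂ := fun c₀ c₁ c₂ => by
    rw [integral_add (f := fun ω => c₀ + X ω * c₁) ((integrable_const _).add (h1.mul_const _))
      (h2.mul_const _), integral_add (integrable_const _) (h1.mul_const _), integral_const,
      integral_mul_const, integral_mul_const]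
    simp
  exact key _ _ _

lemma Bbar_eq_meanB {Ω : Type*} [MeasurableSpace Ω] {μ : Measure Ω} [IsProbabilityMeasure μ]
    {X : Ω → ℝ} (hX : MemLp X 2 μ) :
    Bbar μ α β γ X = meanB α β γ (∫ ω, X ω ∂μ) (∫ ω, X ω ^ 2 ∂μ) := by
  simp only [Bbar, meanB, integral_Phi hX]

lemma blockDiag_mul_kronecker_apply (M : Fin n → Matrix (Fin 2) (Fin 2) ℝ)
    (A : Matrix (Fin n) (Fin n) ℝ) (p q : Fin n × Fin 2) :
    (blockDiag M * (A ⊗ₖ (1 : Matrix (Fin 2) (Fin 2) ℝ))) p q = M p.1 p.2 q.2 * A p.1 q.1 := by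
  obtain ⟨i, k⟩ := p
  obtain ⟨j, l⟩ := q
  simp [Matrix.mul_apply, Fintype.sum_prod_type, blockDiag, Matrix.blockDiagonal_apply,
    Matrix.kroneckerMap_apply, Matrix.one_apply]

lemma meanB_apply (m s : ℝ) (p q : Fin n × Fin 2) :
    meanB α β γ m s p q = meanPhi (α p.1) (β p.1) m s p.2 q.2 * Gam γ p.1 q.1 :=
  blockDiag_mul_kronecker_apply _ _ _ _

lemma meanB_affine (m s : ℝ) : meanB α β γ m s = meanB α β γ 0 0 +
    m • (meanB α β γ 1 0 - meanB α β γ 0 0) + s • (meanB α β γ 0 1 - meanB α β γ 0 0) := by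
  ext p q
  simp only [Matrix.add_apply, Matrix.smul_apply, Matrix.sub_apply, smul_eq_mul, meanB_apply]
  rw [meanPhi_affine]
  simp only [Matrix.add_apply, Matrix.smul_apply, Matrix.sub_apply, smul_eq_mul]
  ring

lemma meanB_sum_smul {V : Type*} [AddCommGroup V] [Module ℝ V] (m s : ℝ) (w : Fin n × Fin 2 → V)
    (i : Fin n) (k : Fin 2) :
    ∑ q, meanB α β γ m s (i, k) q • w q =
      meanPhi (α i) (β i) m s k 0 • (∑ j, γ i j • (w (j, 0) - w (i, 0))) +
      meanPhi (α i) (β i) m s k 1 • (∑ j, γ i j • (w (j, 1) - w (i, 1))) := by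
  simp only [← Gam_sum_smul γ (fun j => w (j, 0)), ← Gam_sum_smul γ (fun j => w (j, 1)),
    Fintype.sum_prod_type, Fin.sum_univ_two, meanB_apply, mul_smul, Finset.sum_add_distrib,
    ← Finset.smul_sum]

lemma meanB_mulVec (m s : ℝ) (v : Fin n × Fin 2 → ℝ) (i : Fin n) (k : Fin 2) :
    (meanB α β γ m s *ᵥ v) (i, k) =
      meanPhi (α i) (β i) m s k 0 * (∑ j, γ i j * (v (j, 0) - v (i, 0))) +
      meanPhi (α i) (β i) m s k 1 * (∑ j, γ i j * (v (j, 1) - v (i, 1))) :=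
  meanB_sum_smul m s v i k

lemma meanB_mulVec_i₁ (m s : ℝ) : meanB α β γ m s *ᵥ i₁ n = 0 := by
  ext ⟨i, k⟩
  simp [meanB_mulVec, i₁]

lemma meanB_mulVec_i₂ (m s : ℝ) : meanB α β γ m s *ᵥ i₂ n = 0 := by
  ext ⟨i, k⟩
  simp [meanB_mulVec, i₂]

lemma meanB_ker (hα : ∀ i, α i ≠ 0) (hpos : ∀ i j, G.Adj j i → 0 < γ i j)
    (hzero : ∀ i j, ¬ G.Adj j i → γ i j = 0) (hG : HasSpanningTree G) {m s : ℝ} (hs : m ^ 2 < s)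
    {v : Fin n × Fin 2 → ℝ} (hv : meanB α β γ m s *ᵥ v = 0) :
    ∃ c₁ c₂ : ℝ, v = c₁ • i₁ n + c₂ • i₂ n := by
  have key : ∀ i, (∑ j, γ i j * (v (j, 0) - v (i, 0))) = 0 ∧
      (∑ j, γ i j * (v (j, 1) - v (i, 1))) = 0 := by
    intro i
    have h0 := congrFun hv (i, 0)
    have h1 := congrFun hv (i, 1)
    rw [meanB_mulVec] at h0 h1
    set g0 := ∑ j, γ i j * (v (j, 0) - v (i, 0))
    set g1 := ∑ j, γ i j * (v (j, 1) - v (i, 1))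
    simp only [meanPhi, Matrix.of_apply, Matrix.cons_val_zero, Matrix.cons_val_one,
      Pi.zero_apply] at h0 h1
    -- This is the determinant of the `2 × 2` block; the two combinations below are the rows of its
    -- adjugate.
    have hdet : α i ^ 2 * (s - m ^ 2) ≠ 0 :=
      mul_ne_zero (pow_ne_zero 2 (hα i)) (sub_pos.2 hs).ne'
    constructor
    · refine (mul_eq_zero.1 (?_ : α i ^ 2 * (s - m ^ 2) * g0 = 0)).resolve_left hdet
      linear_combination (1 + β i * (α i * m + β i)) * h0 - (α i * (α i * m + β i)) * h1
    · refine (mul_eq_zero.1 (?_ : α i ^ 2 * (s - m ^ 2) * g1 = 0)).resolve_left hdet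
      linear_combination (α i * (α i * s + β i * m)) * h1 -
        (m + β i * (α i * s + β i * m)) * h0
  have hr := hG
  obtain ⟨r, -⟩ := hr
  refine ⟨v (r, 0), v (r, 1), ?_⟩
  ext ⟨i, k⟩
  fin_cases k
  · simpa [i₁, i₂] using eq_of_harmonic hpos hzero hG (f := fun j => v (j, 0))
      (fun i => (key i).1) i r
  · simpa [i₁, i₂] using eq_of_harmonic hpos hzero hG (f := fun j => v (j, 1))
      (fun i => (key i).2) i r

lemma meanB_range_inter (hn : 0 < n) (hγ : ∀ i j, 0 ≤ γ i j) {m s : ℝ} {v : Fin n × Fin 2 → ℝ}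
    {c₁ c₂ : ℝ} (hv : meanB α β γ m s *ᵥ v = c₁ • i₁ n + c₂ • i₂ n) : c₁ = 0 ∧ c₂ = 0 := by
  -- The scalar function is `j ↦ ⟨S c, v_j⟩`. At a maximizer `i`, with `g` the disagreement vector,
  -- `⟨c, S g⟩ ≤ 0`. But `c = A_i A_iᵀ S g`, so `⟨c, S g⟩ = ‖A_iᵀ S g‖²`, which must vanish, and `c`
  -- with it.
  obtain ⟨i, hi⟩ := exists_sum_nonpos hn hγ
    (fun j => (s * c₁ + m * c₂) * v (j, 0) + (m * c₁ + c₂) * v (j, 1))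
  have h0 := congrFun hv (i, 0)
  have h1 := congrFun hv (i, 1)
  rw [meanB_mulVec] at h0 h1
  have e : ∑ j, γ i j * ((s * c₁ + m * c₂) * v (j, 0) + (m * c₁ + c₂) * v (j, 1) -
      ((s * c₁ + m * c₂) * v (i, 0) + (m * c₁ + c₂) * v (i, 1))) =
      (s * c₁ + m * c₂) * (∑ j, γ i j * (v (j, 0) - v (i, 0))) +
      (m * c₁ + c₂) * (∑ j, γ i j * (v (j, 1) - v (i, 1))) := by
    rw [Finset.mul_sum, Finset.mul_sum, ← Finset.sum_add_distrib]
    exact Finset.sum_congr rfl fun j _ => by ring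
  rw [e] at hi
  set g0 := ∑ j, γ i j * (v (j, 0) - v (i, 0))
  set g1 := ∑ j, γ i j * (v (j, 1) - v (i, 1))
  simp [meanPhi, i₁, i₂] at h0 h1
  set u0 := s * g0 + m * g1 with hu0
  set u1 := m * g0 + g1 with hu1
  have hc₁ : c₁ = α i * (α i * u0 + β i * u1) := by rw [← h0]; ring
  have hc₂ : c₂ = β i * (α i * u0 + β i * u1) + u1 := by rw [← h1]; ring
  have hq : (α i * u0 + β i * u1) ^ 2 + u1 ^ 2 ≤ 0 := by
    have : (α i * u0 + β i * u1) ^ 2 + u1 ^ 2 = c₁ * u0 + c₂ * u1 := by rw [hc₁, hc₂]; ring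
    rw [this, hu0, hu1]
    linarith
  have hy : α i * u0 + β i * u1 = 0 := by
    rw [← sq_eq_zero_iff]; nlinarith [sq_nonneg (α i * u0 + β i * u1), sq_nonneg u1]
  have hu : u1 = 0 := by
    rw [← sq_eq_zero_iff]; nlinarith [sq_nonneg (α i * u0 + β i * u1), sq_nonneg u1]
  rw [hc₁, hc₂, hy, hu]
  simp

/-- The nonzero eigenvalues of the mean matrix have negative real parts. -/
lemma meanB_eigenvector_eq_zero (hγ : ∀ i j, 0 ≤ γ i j) {m s : ℝ}
    (hs : m ^ 2 < s) {z : ℂ} (hz : z ≠ 0) (hre : 0 ≤ z.re) {w : Fin n × Fin 2 → ℂ}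
    (hw : ∀ p, ∑ q, meanB α β γ m s p q • w q = z * w p) : w = 0 := by
  set v : ℝ := √(s - m ^ 2) with hv
  have hv0 : 0 < v := Real.sqrt_pos.2 (sub_pos.2 hs)
  have hv2 : (v : ℂ) ^ 2 = s - m ^ 2 := by
    rw [← Complex.ofReal_pow, hv, Real.sq_sqrt (sub_pos.2 hs).le]; push_cast; ring
  set g : Fin n → Fin 2 → ℂ := fun i l => ∑ j, γ i j • (w (j, l) - w (i, l)) with hg
  -- Cholesky coordinates for `S`: the standard inner product of `u i` and `h i` is the `S`-inner
  -- product of the block `w_i` and its disagreement `g i`.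
  set u : Fin n → EuclideanSpace ℂ (Fin 2) := fun i =>
    !₂[(v : ℂ) * w (i, 0), (m : ℂ) * w (i, 0) + w (i, 1)] with hu
  set h : Fin n → EuclideanSpace ℂ (Fin 2) := fun i =>
    !₂[(v : ℂ) * g i 0, (m : ℂ) * g i 0 + g i 1] with hh
  have hw0 : ∀ i, z * w (i, 0) =
      α i * (α i * (s * g i 0 + m * g i 1) + β i * (m * g i 0 + g i 1)) := by
    intro i
    rw [← hw, meanB_sum_smul]
    change meanPhi (α i) (β i) m s 0 0 • g i 0 + meanPhi (α i) (β i) m s 0 1 • g i 1 = _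
    simp only [meanPhi, Matrix.of_apply, Matrix.cons_val_zero, Matrix.cons_val_one,
      Complex.real_smul]
    push_cast
    ring
  have hw1 : ∀ i, z * w (i, 1) =
      β i * (α i * (s * g i 0 + m * g i 1) + β i * (m * g i 0 + g i 1)) +
        (m * g i 0 + g i 1) := by
    intro i
    rw [← hw, meanB_sum_smul]
    change meanPhi (α i) (β i) m s 1 0 • g i 0 + meanPhi (α i) (β i) m s 1 1 • g i 1 = _
    simp only [meanPhi, Matrix.of_apply, Matrix.cons_val_zero, Matrix.cons_val_one,
      Complex.real_smul]
    push_cast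
    ring
  have hsum : ∀ i, h i = ∑ j, (γ i j : ℂ) • (u j - u i) := by
    intro i
    ext k
    fin_cases k
    · simp [hh, hu, hg, Finset.mul_sum, WithLp.ofLp_sum]
      exact Finset.sum_congr rfl fun j _ => by ring
    · simp [hh, hu, hg, Finset.mul_sum, WithLp.ofLp_sum, ← Finset.sum_add_distrib]
      exact Finset.sum_congr rfl fun j _ => by ring
  have hinner : ∀ i, 0 ≤ (inner ℂ (u i) (h i)).re := by
    intro i
    set y : ℂ := α i * (s * g i 0 + m * g i 1) + β i * (m * g i 0 + g i 1) with hy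
    set q : ℂ := m * g i 0 + g i 1 with hq
    -- Here `(y, q) = A_iᵀ S g`, and the eigenvalue equation reads `z w_i = A_i (y, q)`. Thus `⟨u i,
    -- h i⟩` is a nonnegative multiple of `z`, and its real part inherits the sign of `z.re`.
    have e : (starRingEnd ℂ) z * inner ℂ (u i) (h i) = ((‖y‖ ^ 2 + ‖q‖ ^ 2 : ℝ) : ℂ) := by
      have c0 := congrArg (starRingEnd ℂ) (hw0 i)
      have c1 := congrArg (starRingEnd ℂ) (hw1 i)
      simp only [map_mul, map_add, Complex.conj_ofReal, ← hy, ← hq] at c0 c1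
      have e1 : inner ℂ (u i) (h i) = (starRingEnd ℂ) (w (i, 0)) * (s * g i 0 + m * g i 1) +
          (starRingEnd ℂ) (w (i, 1)) * q := by
        simp [PiLp.inner_apply, Fin.sum_univ_two, hu, hh]
        rw [hq]
        linear_combination ((starRingEnd ℂ) (w (i, 0)) * g i 0) * hv2
      push_cast
      rw [← Complex.conj_mul', ← Complex.conj_mul', e1]
      have cy : y = α i * (s * g i 0 + m * g i 1) + β i * q := hy
      have cy' : (starRingEnd ℂ) y * y = (starRingEnd ℂ) y *
        (α i * (s * g i 0 + m * g i 1) + β i * q) := by rw [← cy]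
      rw [cy', mul_add, ← mul_assoc, c0, ← mul_assoc, c1]
      ring
    have hn : (‖z‖ ^ 2 : ℝ) * (inner ℂ (u i) (h i)).re = z.re * (‖y‖ ^ 2 + ‖q‖ ^ 2) := by
      have e2 : ((‖z‖ ^ 2 : ℝ) : ℂ) * inner ℂ (u i) (h i) =
          z * ((‖y‖ ^ 2 + ‖q‖ ^ 2 : ℝ) : ℂ) := by
        rw [← e]; push_cast; rw [← Complex.mul_conj']; ring
      have := congrArg Complex.re e2
      rwa [Complex.re_ofReal_mul, mul_comm z, Complex.re_ofReal_mul, mul_comm _ z.re] at this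
    have hzn : 0 < ‖z‖ ^ 2 := by positivity
    have : 0 ≤ (‖z‖ ^ 2 : ℝ) * (inner ℂ (u i) (h i)).re := by rw [hn]; positivity
    exact nonneg_of_mul_nonneg_right this hzn
  have hvC : (v : ℂ) ≠ 0 := Complex.ofReal_ne_zero.2 hv0.ne'
  have h0 : ∀ i, h i = 0 → u i = 0 := by
    intro i hi
    have a0 := congrArg (fun x : EuclideanSpace ℂ (Fin 2) => x 0) hi
    have a1 := congrArg (fun x : EuclideanSpace ℂ (Fin 2) => x 1) hi
    simp [hh, hv0.ne'] at a0 a1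
    have b0 := hw0 i
    have b1 := hw1 i
    rw [a0] at a1
    simp at a1
    simp [a0, a1, hz] at b0 b1
    ext k
    fin_cases k <;> simp [hu, b0, b1]
  have hu0 := eq_zero_of_re_inner_nonneg hγ hsum hinner h0
  have hw00 : ∀ i, w (i, 0) = 0 := fun i => by
    have a0 := congrArg (fun x : EuclideanSpace ℂ (Fin 2) => x 0) (hu0 i)
    simpa [hu, hv0.ne'] using a0
  ext ⟨i, k⟩
  fin_cases k
  · exact hw00 i
  · have a1 := congrArg (fun x : EuclideanSpace ℂ (Fin 2) => x 1) (hu0 i)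
    simpa [hu, hw00 i] using a1

end MeanMatrix

/-! ### From eigenvalues in the left half-plane to a small power of `1 + s A`. -/

section Stability

open scoped Matrix.Norms.Operator ENNReal NNReal

lemma linfty_opNorm_map_ofReal {ι : Type*} [Fintype ι] (A : Matrix ι ι ℝ) :
    ‖A.map Complex.ofReal‖ = ‖A‖ := by
  simp [Matrix.linfty_opNorm_def]

lemma exists_pow_norm_le_half_of_spectrum {R : Type*} [NormedRing R] [NormedAlgebra ℂ R]
    [CompleteSpace R] [Nontrivial R] {a : R} (ha : ∀ z ∈ spectrum ℂ a, ‖z‖ < 1) :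
    ∃ N > 0, ‖a ^ N‖ ≤ 1 / 2 := by
  have h1 : spectralRadius ℂ a < ((1 : ℝ≥0) : ℝ≥0∞) :=
    spectrum.spectralRadius_lt_of_forall_lt a fun z hz => by exact_mod_cast ha z hz
  obtain ⟨q, hq, hq1⟩ := ENNReal.lt_iff_exists_nnreal_btwn.1 h1
  have hq1' : q < 1 := by exact_mod_cast hq1
  have h2 := (spectrum.pow_nnnorm_pow_one_div_tendsto_nhds_spectralRadius a).eventually_lt_const hq
  have h3 : ∀ᶠ N : ℕ in atTop, q ^ N < 1 / 2 :=
    (tendsto_pow_atTop_nhds_zero_of_lt_one zero_le hq1').eventually_lt_const (by norm_num)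
  obtain ⟨N, ⟨hN2, hN3⟩, hN0⟩ := ((h2.and h3).and (eventually_gt_atTop 0)).exists
  refine ⟨N, hN0, ?_⟩
  have hN0' : (0 : ℝ) < N := Nat.cast_pos.2 hN0
  have h4 : (‖a ^ N‖₊ : ℝ≥0∞) < (q : ℝ≥0∞) ^ N := by
    have := ENNReal.rpow_lt_rpow hN2 hN0'
    rwa [← ENNReal.rpow_mul, one_div_mul_cancel hN0'.ne', ENNReal.rpow_one,
      ENNReal.rpow_natCast] at this
  have h5 : ‖a ^ N‖₊ < q ^ N := by exact_mod_cast h4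
  have h6 : ‖a ^ N‖₊ ≤ 1 / 2 := (h5.trans hN3).le
  exact_mod_cast h6

/-- If all the eigenvalues of `A` have negative real parts, then some `1 + s A` with `s > 0` has a
small power. -/
lemma exists_pow_norm_le_half {ι : Type*} [Fintype ι] [DecidableEq ι] [Nonempty ι]
    {A : Matrix ι ι ℝ}
    (hA : ∀ (z : ℂ) (w : ι → ℂ), 0 ≤ z.re → (∀ p, ∑ q, A p q • w q = z * w p) → w = 0) :
    ∃ s > 0, ∃ N > 0, ‖(1 + (s : ℝ) • A) ^ N‖ ≤ 1 / 2 := by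
  set C : Matrix ι ι ℂ := A.map Complex.ofReal with hC
  have hspec : ∀ z ∈ spectrum ℂ C, z.re < 0 := by
    intro z hz
    rw [← Matrix.spectrum_toLin', ← Module.End.hasEigenvalue_iff_mem_spectrum] at hz
    obtain ⟨w, hw⟩ := hz.exists_hasEigenvector
    by_contra hre
    refine hw.2 (hA z w (not_lt.1 hre) fun p => ?_)
    have := congrFun hw.apply_eq_smul p
    simpa [hC, Matrix.mulVec, dotProduct] using this
  have hfin : (spectrum ℂ C).Finite := by
    rw [← Matrix.spectrum_toLin']
    exact Module.End.finite_spectrum _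
  -- Since `‖1 + s z‖² = 1 + s (2 Re z + s ‖z‖²)`, each eigenvalue allows all small `s > 0`;
  -- finiteness of the spectrum gives a common `s`. Gelfand's formula then applies to the
  -- complexification, which has the same norm.
  have hev : ∀ᶠ s : ℝ in 𝓝[>] 0, ∀ z ∈ spectrum ℂ C, ‖1 + s * z‖ < 1 := by
    rw [hfin.eventually_all]
    intro z hz
    have hz0 := hspec z hz
    have hc : Continuous fun s : ℝ => 2 * z.re + s * ‖z‖ ^ 2 := by fun_prop
    have h1 : ∀ᶠ s : ℝ in 𝓝[>] 0, 2 * z.re + s * ‖z‖ ^ 2 < 0 :=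
      nhdsWithin_le_nhds ((hc.tendsto 0).eventually_lt_const (by simp; linarith))
    filter_upwards [h1, self_mem_nhdsWithin] with s hs hs0
    have e : ‖1 + s * z‖ ^ 2 = 1 + s * (2 * z.re + s * ‖z‖ ^ 2) := by
      rw [← Complex.normSq_eq_norm_sq, ← Complex.normSq_eq_norm_sq, Complex.normSq_apply,
        Complex.normSq_apply]
      simp
      ring
    have : s * (2 * z.re + s * ‖z‖ ^ 2) < 0 := mul_neg_of_pos_of_neg hs0 hs
    exact (sq_lt_one_iff₀ (norm_nonneg _)).1 (by linarith)
  obtain ⟨s, hs, hs0⟩ := (hev.and self_mem_nhdsWithin).exists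
  have hs0' : (0 : ℝ) < s := hs0
  have hsC : (s : ℂ) ≠ 0 := Complex.ofReal_ne_zero.2 hs0'.ne'
  obtain ⟨N, hN, hle⟩ := exists_pow_norm_le_half_of_spectrum (a := 1 + (s : ℂ) • C) (by
    intro z hz
    have h1 : (z - 1) / s ∈ spectrum ℂ C := by
      rw [spectrum.mem_iff] at hz ⊢
      refine fun h => hz ?_
      have e : algebraMap ℂ (Matrix ι ι ℂ) z - (1 + (s : ℂ) • C) =
          (s : ℂ) • (algebraMap ℂ (Matrix ι ι ℂ) ((z - 1) / s) - C) := by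
        rw [smul_sub, Algebra.algebraMap_eq_smul_one, Algebra.algebraMap_eq_smul_one, smul_smul,
          mul_div_cancel₀ _ hsC, sub_smul, one_smul]
        abel
      rw [e]
      exact h.smul (Units.mk0 (s : ℂ) hsC)
    have h2 := hs _ h1
    rwa [mul_div_cancel₀ _ hsC, add_sub_cancel] at h2)
  refine ⟨s, hs0', N, hN, ?_⟩
  have e : (1 + (s : ℂ) • C) ^ N = ((1 + s • A) ^ N).map Complex.ofReal := by
    have h := map_pow (RingHom.mapMatrix (m := ι) Complex.ofRealHom) (1 + s • A) N
    have h2 : (RingHom.mapMatrix (m := ι) Complex.ofRealHom) (1 + s • A) = 1 + (s : ℂ) • C := by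
      rw [map_add, map_one]
      congr 1
      ext p q
      simp [hC]
    rw [← h2, ← h]
    rfl
  rwa [e, linfty_opNorm_map_ofReal] at hle

end Stability

/-! ### The normalized left null vectors and the projection onto consensus. -/

section LeftPair

variable {n : ℕ} {M : Matrix (Fin n × Fin 2) (Fin n × Fin 2) ℝ} {π₁ π₂ : Fin n × Fin 2 → ℝ}

lemma exists_dotProduct_eq {ι : Type*} [Fintype ι] [DecidableEq ι] (f : (ι → ℝ) →ₗ[ℝ] ℝ) :
    ∃ π : ι → ℝ, ∀ v, f v = π ⬝ᵥ v :=
  ⟨fun p => f (Pi.single p 1), fun v => by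
    rw [LinearMap.pi_apply_eq_sum_univ f v]
    refine Finset.sum_congr rfl fun p _ => ?_
    rw [smul_eq_mul, mul_comm]
    congr 2
    ext q
    simp [Pi.single_apply, eq_comm]⟩

/-- A vector outside the sum of the range of a matrix and a line is separated from it by a left
null vector. -/
lemma exists_left_null {ι : Type*} [Fintype ι] [DecidableEq ι] {A : Matrix ι ι ℝ} {u v : ι → ℝ}
    (h : ∀ (x : ι → ℝ) (c : ℝ), A *ᵥ x ≠ u + c • v) :
    ∃ π : ι → ℝ, π ᵥ* A = 0 ∧ π ⬝ᵥ u = 1 ∧ π ⬝ᵥ v = 0 := by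
  have hu : u ∉ LinearMap.range A.mulVecLin ⊔ Submodule.span ℝ {v} := by
    intro hmem
    obtain ⟨y, ⟨x, rfl⟩, z, hz, hyz⟩ := Submodule.mem_sup.1 hmem
    obtain ⟨c, rfl⟩ := Submodule.mem_span_singleton.1 hz
    exact h x (-c) (by rw [← hyz]; simp)
  obtain ⟨f, hfu, hf⟩ := Submodule.exists_le_ker_of_notMem hu
  obtain ⟨π, hπ⟩ := exists_dotProduct_eq f
  rw [hπ] at hfu
  refine ⟨(π ⬝ᵥ u)⁻¹ • π, ?_, ?_, ?_⟩
  · refine dotProduct_eq_zero _ fun x => ?_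
    rw [← Matrix.dotProduct_mulVec, smul_dotProduct, ← hπ (A *ᵥ x)]
    have : A *ᵥ x ∈ LinearMap.ker f :=
      hf (Submodule.mem_sup_left (LinearMap.mem_range_self A.mulVecLin x))
    rw [LinearMap.mem_ker.1 this, smul_zero]
  · rw [smul_dotProduct, smul_eq_mul, inv_mul_cancel₀ hfu]
  · have : v ∈ LinearMap.ker f :=
      hf (Submodule.mem_sup_right (Submodule.mem_span_singleton_self v))
    rw [smul_dotProduct, ← hπ v, LinearMap.mem_ker.1 this, smul_zero]

lemma exists_isNormalizedLeftPair
    (hM : ∀ v (c₁ c₂ : ℝ), M *ᵥ v = c₁ • i₁ n + c₂ • i₂ n → c₁ = 0 ∧ c₂ = 0) :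
    ∃ π₁ π₂, IsNormalizedLeftPair M π₁ π₂ := by
  obtain ⟨π₁, h1, h11, h12⟩ := exists_left_null (A := M) (u := i₁ n) (v := i₂ n) fun x c hx =>
    one_ne_zero (hM x 1 c (by rw [hx, one_smul])).1
  obtain ⟨π₂, h2, h22, h21⟩ := exists_left_null (A := M) (u := i₂ n) (v := i₁ n) fun x c hx =>
    one_ne_zero (hM x c 1 (by rw [hx, one_smul, add_comm])).2
  exact ⟨π₁, π₂, h1, h2, h11, h12, h21, h22⟩

/-- If the range and the kernel of `A` are complementary, then a left null vector is determined by
its values on the kernel. -/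
lemma left_null_eq_zero {ι : Type*} [Fintype ι] [DecidableEq ι] {A : Matrix ι ι ℝ}
    (hdisj : ∀ x, A *ᵥ (A *ᵥ x) = 0 → A *ᵥ x = 0) {d : ι → ℝ} (hd : d ᵥ* A = 0)
    (hker : ∀ x, A *ᵥ x = 0 → d ⬝ᵥ x = 0) : d = 0 := by
  have htop : LinearMap.range A.mulVecLin ⊔ LinearMap.ker A.mulVecLin = ⊤ := by
    refine Submodule.eq_top_of_disjoint _ _ ?_ ?_
    · rw [LinearMap.finrank_range_add_finrank_ker]
    · rw [Submodule.disjoint_def]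
      rintro _ ⟨x, rfl⟩ hx
      exact hdisj x hx
  refine dotProduct_eq_zero _ fun x => ?_
  have hx : x ∈ LinearMap.range A.mulVecLin ⊔ LinearMap.ker A.mulVecLin := htop ▸ Submodule.mem_top
  obtain ⟨_, ⟨y, rfl⟩, z, hz, rfl⟩ := Submodule.mem_sup.1 hx
  rw [dotProduct_add, hker z hz, add_zero, Matrix.mulVecLin_apply, Matrix.dotProduct_mulVec, hd,
    zero_dotProduct]

/-- The difference of two candidates kills the range as a left null vector and kills the kernel by
the normalization; the two hypotheses make range and kernel complementary. -/
lemma IsNormalizedLeftPair.unique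
    (hker : ∀ v, M *ᵥ v = 0 → ∃ c₁ c₂ : ℝ, v = c₁ • i₁ n + c₂ • i₂ n)
    (hM : ∀ v (c₁ c₂ : ℝ), M *ᵥ v = c₁ • i₁ n + c₂ • i₂ n → c₁ = 0 ∧ c₂ = 0)
    {π₁' π₂' : Fin n × Fin 2 → ℝ} (h : IsNormalizedLeftPair M π₁ π₂)
    (h' : IsNormalizedLeftPair M π₁' π₂') : π₁' = π₁ ∧ π₂' = π₂ := by
  have hdisj : ∀ x, M *ᵥ (M *ᵥ x) = 0 → M *ᵥ x = 0 := fun x hx => by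
    obtain ⟨c₁, c₂, hc⟩ := hker _ hx
    obtain ⟨h1, h2⟩ := hM x c₁ c₂ hc
    rw [hc, h1, h2]; simp
  obtain ⟨a1, a2, a11, a12, a21, a22⟩ := h
  obtain ⟨b1, b2, b11, b12, b21, b22⟩ := h'
  constructor
  · refine sub_eq_zero.1 (left_null_eq_zero hdisj ?_ fun x hx => ?_)
    · rw [Matrix.sub_vecMul, a1, b1, sub_zero]
    · obtain ⟨c₁, c₂, rfl⟩ := hker x hx
      simp [sub_dotProduct, dotProduct_add, dotProduct_smul, a11, a12, b11, b12]
  · refine sub_eq_zero.1 (left_null_eq_zero hdisj ?_ fun x hx => ?_)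
    · rw [Matrix.sub_vecMul, a2, b2, sub_zero]
    · obtain ⟨c₁, c₂, rfl⟩ := hker x hx
      simp [sub_dotProduct, dotProduct_add, dotProduct_smul, a21, a22, b21, b22]

/-- The projection onto the span of `i₁`, `i₂` given by a normalized pair. -/
def consensusProj (π₁ π₂ : Fin n × Fin 2 → ℝ) : Matrix (Fin n × Fin 2) (Fin n × Fin 2) ℝ :=
  Matrix.vecMulVec (i₁ n) π₁ + Matrix.vecMulVec (i₂ n) π₂

lemma IsNormalizedLeftPair.proj_mul (h : IsNormalizedLeftPair M π₁ π₂) :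
    consensusProj π₁ π₂ * M = 0 := by
  rw [consensusProj, add_mul, Matrix.vecMulVec_mul, Matrix.vecMulVec_mul, h.1, h.2.1]
  simp

lemma IsNormalizedLeftPair.proj_mul_proj (h : IsNormalizedLeftPair M π₁ π₂) :
    consensusProj π₁ π₂ * consensusProj π₁ π₂ = consensusProj π₁ π₂ := by
  obtain ⟨-, -, h11, h12, h21, h22⟩ := h
  simp only [consensusProj, add_mul, mul_add, Matrix.vecMulVec_mul_vecMulVec, h11, h12, h21, h22]
  simp

lemma mul_consensusProj (hi₁ : M *ᵥ i₁ n = 0) (hi₂ : M *ᵥ i₂ n = 0) :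
    M * consensusProj π₁ π₂ = 0 := by
  rw [consensusProj, mul_add, Matrix.mul_vecMulVec, Matrix.mul_vecMulVec, hi₁, hi₂]
  simp

lemma sum_mul_smul {ι : Type*} [Fintype ι] (A C : Matrix ι ι ℝ) (w : ι → ℂ) (p : ι) :
    ∑ q, (A * C) p q • w q = ∑ r, A p r • ∑ q, C r q • w q := by
  simp only [Matrix.mul_apply, Finset.sum_smul, Finset.smul_sum, smul_smul]
  exact Finset.sum_comm

/-- Subtracting the projection moves the eigenvalue `0` of the mean matrix to `-1`. -/
lemma IsNormalizedLeftPair.eigenvector_sub_proj_eq_zero (h : IsNormalizedLeftPair M π₁ π₂)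
    (hker : ∀ v, M *ᵥ v = 0 → ∃ c₁ c₂ : ℝ, v = c₁ • i₁ n + c₂ • i₂ n)
    (heig : ∀ (z : ℂ) (w : Fin n × Fin 2 → ℂ), z ≠ 0 → 0 ≤ z.re →
      (∀ p, ∑ q, M p q • w q = z * w p) → w = 0)
    {z : ℂ} {w : Fin n × Fin 2 → ℂ} (hz : 0 ≤ z.re)
    (hw : ∀ p, ∑ q, (M - consensusProj π₁ π₂) p q • w q = z * w p) : w = 0 := by
  set P := consensusProj π₁ π₂ with hP
  -- Applying `P` to the eigenvalue equation gives `(z + 1) P w = 0`, and `z ≠ -1` because `0 ≤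
  -- z.re`. So `P w = 0` and `w` is an eigenvector of `M` itself.
  have hPM : P * (M - P) = -P := by rw [mul_sub, h.proj_mul, h.proj_mul_proj, zero_sub]
  have hPw : ∀ p, ∑ q, P p q • w q = 0 := fun p => by
    have h1 := sum_mul_smul P (M - P) w p
    rw [hPM] at h1
    simp only [hw, Matrix.neg_apply, neg_smul, Finset.sum_neg_distrib, ← mul_smul_comm,
      ← Finset.mul_sum] at h1
    have h2 : (z + 1) * ∑ q, P p q • w q = 0 := by rw [add_mul, one_mul, ← h1]; ring
    refine (mul_eq_zero.1 h2).resolve_left fun h3 => ?_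
    have := congrArg Complex.re h3
    simp at this
    linarith
  have hMw : ∀ p, ∑ q, M p q • w q = z * w p := fun p => by
    have := hw p
    simpa only [Matrix.sub_apply, sub_smul, Finset.sum_sub_distrib, hPw, sub_zero] using this
  by_cases hz0 : z = 0
  · have key : ∀ v : Fin n × Fin 2 → ℝ, M *ᵥ v = 0 → P *ᵥ v = 0 → v = 0 := by
      intro v hv hPv
      obtain ⟨c₁, c₂, rfl⟩ := hker v hv
      rw [← hPv]
      obtain ⟨-, -, h11, h12, h21, h22⟩ := h
      simp [hP, consensusProj, Matrix.mulVec_add, Matrix.mulVec_smul, Matrix.add_mulVec,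
        Matrix.vecMulVec_mulVec, h11, h12, h21, h22]
    have hre := key (fun p => (w p).re)
      (by ext p; simpa [hz0, Matrix.mulVec, dotProduct] using congrArg Complex.re (hMw p))
      (by ext p; simpa [Matrix.mulVec, dotProduct] using congrArg Complex.re (hPw p))
    have him := key (fun p => (w p).im)
      (by ext p; simpa [hz0, Matrix.mulVec, dotProduct] using congrArg Complex.im (hMw p))
      (by ext p; simpa [Matrix.mulVec, dotProduct] using congrArg Complex.im (hPw p))
    ext p
    exact Complex.ext (congrFun hre p) (congrFun him p)
  · exact heig z w hz0 hz hMw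

/-- A left null vector of the mean matrix is a left null vector for all signal moments. -/
lemma vecMul_meanB_eq_zero {α β : Fin n → ℝ} {γ : Fin n → Fin n → ℝ} {m s : ℝ} (hs : m ^ 2 < s)
    {π : Fin n × Fin 2 → ℝ} (hπ : π ᵥ* meanB α β γ m s = 0) (m' s' : ℝ) :
    π ᵥ* meanB α β γ m' s' = 0 := by
  have hv : s - m ^ 2 ≠ 0 := (sub_pos.2 hs).ne'
  -- The coefficients in `e0` and `e1` are the columns of `S⁻¹ S'`. As `A_i A_iᵀ S' = (A_i A_iᵀ S)
  -- (S⁻¹ S')` with the last factor the same for all sensors, the new matrix is the old one times `I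
  -- ⊗ S⁻¹ S'`.
  have e0 : ∀ p j, meanB α β γ m' s' p (j, 0) =
      meanB α β γ m s p (j, 0) * ((s' - m * m') / (s - m ^ 2)) +
      meanB α β γ m s p (j, 1) * ((s * m' - m * s') / (s - m ^ 2)) := by
    intro p j
    obtain ⟨i, k⟩ := p
    fin_cases k <;> simp [meanB_apply, meanPhi] <;> field_simp <;> ring
  have e1 : ∀ p j, meanB α β γ m' s' p (j, 1) =
      meanB α β γ m s p (j, 0) * ((m' - m) / (s - m ^ 2)) +
      meanB α β γ m s p (j, 1) * ((s - m * m') / (s - m ^ 2)) := by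
    intro p j
    obtain ⟨i, k⟩ := p
    fin_cases k <;> simp [meanB_apply, meanPhi] <;> field_simp <;> ring
  have hπ' : ∀ q, ∑ p, π p * meanB α β γ m s p q = 0 := fun q => congrFun hπ q
  ext ⟨j, l⟩
  change ∑ p, π p * meanB α β γ m' s' p (j, l) = 0
  fin_cases l
  · simp only [Fin.zero_eta, e0, mul_add, ← mul_assoc, Finset.sum_add_distrib, ← Finset.sum_mul,
      hπ', zero_mul, add_zero]
  · simp only [Fin.mk_one, e1, mul_add, ← mul_assoc, Finset.sum_add_distrib, ← Finset.sum_mul,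
      hπ', zero_mul, add_zero]

end LeftPair

/-! ### The error recursion and the two modes of convergence. -/

section Convergence

open scoped Matrix.Norms.Operator ENNReal

variable {n : ℕ} {α β : Fin n → ℝ} {γ : Fin n → Fin n → ℝ}
  {P : Matrix (Fin n × Fin 2) (Fin n × Fin 2) ℝ}

/-- The error starts in the kernel of `P` and stays there, and on that kernel `B` and `B - P` agree.
Subtracting `P` thus changes no trajectory of the error but removes the eigenvalue `0` of the mean.
-/
lemma rho_eq (hPB : ∀ ξ, P * B α β γ ξ = 0) (hBP : ∀ ξ, B α β γ ξ * P = 0) (hPP : P * P = P)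
    (δ : ℝ) (ρ₀ : Fin n × Fin 2 → ℝ) (ξ : ℕ → ℝ) (t : ℕ) :
    rho α β γ δ ρ₀ ξ t =
      P *ᵥ ρ₀ + stepProd δ (fun k => B α β γ (ξ k) - P) t *ᵥ (ρ₀ - P *ᵥ ρ₀) := by
  set w := ρ₀ - P *ᵥ ρ₀ with hw
  have hPw : P *ᵥ w = 0 := by rw [hw, Matrix.mulVec_sub, Matrix.mulVec_mulVec, hPP, sub_self]
  have hinv : ∀ t, P *ᵥ (stepProd δ (fun k => B α β γ (ξ k) - P) t *ᵥ w) = 0 := by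
    intro t
    induction t with
    | zero => simp [stepProd, hPw]
    | succ t ih =>
      have e : P * (1 + δ • (B α β γ (ξ t) - P)) = (1 - δ) • P := by
        rw [mul_add, mul_one, mul_smul_comm, mul_sub, hPB, hPP, zero_sub, smul_neg, sub_smul,
          one_smul, sub_eq_add_neg]
      rw [stepProd, ← Matrix.mulVec_mulVec, Matrix.mulVec_mulVec _ P, e, Matrix.smul_mulVec, ih,
        smul_zero]
  induction t with
  | zero => simp [rho, stepProd, hw]
  | succ t ih =>
    have h1 : (1 + δ • B α β γ (ξ t)) *ᵥ (P *ᵥ ρ₀) = P *ᵥ ρ₀ := by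
      rw [Matrix.mulVec_mulVec, add_mul, one_mul, smul_mul_assoc, hBP, smul_zero, add_zero]
    have h2 : ∀ v, P *ᵥ v = 0 → (1 + δ • (B α β γ (ξ t) - P)) *ᵥ v =
        (1 + δ • B α β γ (ξ t)) *ᵥ v := fun v hv => by
      simp [Matrix.add_mulVec, Matrix.smul_mulVec, Matrix.sub_mulVec, hv]
    rw [rho, ih, Matrix.mulVec_add, h1, stepProd, ← Matrix.mulVec_mulVec, h2 _ (hinv t)]

variable {Ω : Type*} [MeasurableSpace Ω] {μ : Measure Ω}

/-- By Tonelli the series `∑ ‖f t‖` has finite integral, so it converges almost surely and its terms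
tend to zero. -/
lemma ae_tendsto_zero_of_tsum_eLpNorm_one {E : Type*} [NormedAddCommGroup E] {f : ℕ → Ω → E}
    (hf : ∀ t, AEStronglyMeasurable (f t) μ) (h : ∑' t, eLpNorm (f t) 1 μ ≠ ∞) :
    ∀ᵐ ω ∂μ, Tendsto (fun t => f t ω) atTop (𝓝 0) := by
  simp only [eLpNorm_one_eq_lintegral_enorm] at h
  rw [← lintegral_tsum fun t => (hf t).enorm] at h
  filter_upwards [ae_lt_top' (AEMeasurable.tsum fun t => (hf t).enorm) h] with ω hω
  have h1 := ENNReal.tendsto_atTop_zero_of_tsum_ne_top hω.ne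
  rw [tendsto_zero_iff_norm_tendsto_zero]
  simpa [Function.comp_def] using (ENNReal.tendsto_toReal ENNReal.zero_ne_top).comp h1

lemma tendsto_integral_norm_sq_zero {E : Type*} [NormedAddCommGroup E] {f : ℕ → Ω → E}
    (hf : ∀ t, MemLp (f t) 2 μ) (h : Tendsto (fun t => eLpNorm (f t) 2 μ) atTop (𝓝 0)) :
    Tendsto (fun t => ∫ ω, ‖f t ω‖ ^ 2 ∂μ) atTop (𝓝 0) := by
  have h1 : ∀ t, ∫ ω, ‖f t ω‖ ^ 2 ∂μ = (eLpNorm (f t) 2 μ).toReal ^ 2 := fun t => by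
    have h0 : 0 ≤ ∫ ω, ‖f t ω‖ ^ 2 ∂μ := integral_nonneg fun ω => sq_nonneg _
    rw [(hf t).eLpNorm_eq_integral_rpow_norm (by norm_num) (by norm_num)]
    simp only [ENNReal.toReal_ofNat, Real.rpow_ofNat]
    rw [ENNReal.toReal_ofReal (by positivity), ← Real.rpow_natCast, ← Real.rpow_mul h0]
    norm_num
  simp only [h1]
  simpa using ((ENNReal.tendsto_toReal ENNReal.zero_ne_top).comp h).pow 2

lemma memLp_quadratic [IsFiniteMeasure μ] {E : Type*} [NormedAddCommGroup E] [NormedSpace ℝ E]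
    {X : Ω → ℝ} {p : ℝ≥0∞} (h1 : MemLp X p μ) (h2 : MemLp (fun ω => X ω ^ 2) p μ)
    (c₀ c₁ c₂ : E) : MemLp (fun ω => c₀ + X ω • c₁ + X ω ^ 2 • c₂) p μ := by
  have h : ∀ {Y : Ω → ℝ} (c : E), MemLp Y p μ → MemLp (fun ω => Y ω • c) p μ := fun c hY =>
    hY.of_le_mul (c := ‖c‖) (hY.1.smul_const c) (ae_of_all _ fun ω => by
      rw [norm_smul, mul_comm])
  exact ((memLp_const c₀).add (h c₁ h1)).add (h c₂ h2)

lemma integral_quadratic [IsProbabilityMeasure μ] {E : Type*} [NormedAddCommGroup E]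
    [NormedSpace ℝ E] [CompleteSpace E] {X : Ω → ℝ} (h1 : Integrable X μ)
    (h2 : Integrable (fun ω => X ω ^ 2) μ) (c₀ c₁ c₂ : E) :
    ∫ ω, (c₀ + X ω • c₁ + X ω ^ 2 • c₂) ∂μ =
      c₀ + (∫ ω, X ω ∂μ) • c₁ + (∫ ω, X ω ^ 2 ∂μ) • c₂ := by
  rw [integral_add (f := fun ω => c₀ + X ω • c₁) ((integrable_const _).add (h1.smul_const _))
    (h2.smul_const _), integral_add (integrable_const _) (h1.smul_const _), integral_const,
    integral_smul_const, integral_smul_const]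
  simp

/-- Summability of the `L^p` norms of products of factors `1 + δ (c₀ + x c₁ + x² c₂)`. -/
lemma exists_step_tsum_quadratic [IsProbabilityMeasure μ] {R : Type*} [NormedRing R]
    [NormedAlgebra ℝ R] [NormOneClass R] [FiniteDimensional ℝ R]
    {x : ℕ → Ω → ℝ} (hx : ∀ t, Measurable (x t)) (hind : iIndepFun x μ)
    (hid : ∀ t, IdentDistrib (x t) (x 0) μ μ) {p : ℝ≥0∞} (hp : 1 ≤ p) (htop : p ≠ ∞)
    (h1 : MemLp (x 0) p μ) (h2 : MemLp (fun ω => x 0 ω ^ 2) p μ) (c₀ c₁ c₂ : R)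
    {s₀ : ℝ} (hs₀ : 0 < s₀) {N : ℕ} (hN : 0 < N)
    (hT : ‖(1 + s₀ • (c₀ + (∫ ω, x 0 ω ∂μ) • c₁ + (∫ ω, x 0 ω ^ 2 ∂μ) • c₂)) ^ N‖ ≤ 1 / 2) :
    ∃ d > 0, ∀ δ : ℝ, 0 < δ → δ ≤ d →
      -- Linear images keep the Borel structure on `R` internal to the proof; the one needed is `X ↦
      -- X *ᵥ w`.
      ∀ {F : Type} [NormedAddCommGroup F] [NormedSpace ℝ F] (L : R →ₗ[ℝ] F),
      (∀ t, AEStronglyMeasurable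
        (fun ω => L (stepProd δ (fun k => c₀ + x k ω • c₁ + x k ω ^ 2 • c₂) t)) μ) ∧
      ∑' t, eLpNorm (fun ω => L (stepProd δ (fun k => c₀ + x k ω • c₁ + x k ω ^ 2 • c₂) t)) p μ
        ≠ ∞ := by
  let _ : MeasurableSpace R := borel R
  have : BorelSpace R := ⟨rfl⟩
  have : ProperSpace R := FiniteDimensional.proper ℝ R
  have hg : Measurable fun ξ : ℝ => c₀ + ξ • c₁ + ξ ^ 2 • c₂ :=
    Continuous.measurable (by fun_prop)
  have hb : ∀ t, Measurable fun ω => c₀ + x t ω • c₁ + x t ω ^ 2 • c₂ := fun t => hg.comp (hx t)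
  rw [← integral_quadratic (h1.integrable hp) (h2.integrable hp)] at hT
  obtain ⟨d, hd, h⟩ := exists_step_tsum_eLpNorm_stepProd_ne_top
    (b := fun t ω => c₀ + x t ω • c₁ + x t ω ^ 2 • c₂) hb
    (hind.comp (fun _ ξ => c₀ + ξ • c₁ + ξ ^ 2 • c₂) fun _ => hg)
    (fun t => (hid t).comp hg) hp htop (memLp_quadratic h1 h2 _ _ _) hs₀ hN hT
  refine ⟨d, hd, fun δ h0 hδ F _ _ L => ⟨fun t => ?_, ?_⟩⟩
  · exact L.continuous_of_finiteDimensional.comp_aestronglyMeasurable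
      ((measurable_stepProd δ t).comp (measurable_pi_iff.2 hb)).aestronglyMeasurable
  · refine ne_top_of_le_ne_top ?_ (ENNReal.tsum_le_tsum fun t =>
      eLpNorm_le_mul_eLpNorm_of_ae_le_mul (c := ‖L.toContinuousLinearMap‖)
        (ae_of_all _ fun ω => L.toContinuousLinearMap.le_opNorm _) p)
    rw [ENNReal.tsum_mul_left]
    exact ENNReal.mul_ne_top ENNReal.ofReal_ne_top (h δ h0 hδ)

lemma B_sub_affine (ξ : ℝ) : B α β γ ξ - P = (meanB α β γ 0 0 - P) +
    ξ • (meanB α β γ 1 0 - meanB α β γ 0 0) + ξ ^ 2 • (meanB α β γ 0 1 - meanB α β γ 0 0) := by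
  rw [B_eq_meanB, meanB_affine]
  abel

/-- Summability of the `L^p` norms of the error, for a signal with moments of order `2 p`. -/
lemma exists_step_tsum_error_ne_top [IsProbabilityMeasure μ] [Nonempty (Fin n)]
    {x : ℕ → Ω → ℝ} (hx : ∀ t, Measurable (x t)) (hind : iIndepFun x μ)
    (hid : ∀ t, IdentDistrib (x t) (x 0) μ μ) {p : ℝ≥0∞} (hp : 1 ≤ p) (htop : p ≠ ∞)
    (h1 : MemLp (x 0) p μ) (h2 : MemLp (fun ω => x 0 ω ^ 2) p μ)
    (hstab : ∀ (z : ℂ) (w : Fin n × Fin 2 → ℂ), 0 ≤ z.re →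
      (∀ p, ∑ q, (meanB α β γ (∫ ω, x 0 ω ∂μ) (∫ ω, x 0 ω ^ 2 ∂μ) - P) p q • w q = z * w p) →
        w = 0) :
    ∃ d > 0, ∀ δ : ℝ, 0 < δ → δ ≤ d → ∀ w : Fin n × Fin 2 → ℝ,
      (∀ t, AEStronglyMeasurable
        (fun ω => stepProd δ (fun k => B α β γ (x k ω) - P) t *ᵥ w) μ) ∧
      ∑' t, eLpNorm (fun ω => stepProd δ (fun k => B α β γ (x k ω) - P) t *ᵥ w) p μ ≠ ∞ := by
  obtain ⟨s, hs, N, hN, hT⟩ := exists_pow_norm_le_half hstab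
  have e : meanB α β γ (∫ ω, x 0 ω ∂μ) (∫ ω, x 0 ω ^ 2 ∂μ) - P = (meanB α β γ 0 0 - P) +
      (∫ ω, x 0 ω ∂μ) • (meanB α β γ 1 0 - meanB α β γ 0 0) +
      (∫ ω, x 0 ω ^ 2 ∂μ) • (meanB α β γ 0 1 - meanB α β γ 0 0) := by
    rw [meanB_affine]
    abel
  rw [e] at hT
  obtain ⟨d, hd, h⟩ := exists_step_tsum_quadratic hx hind hid hp htop h1 h2 _ _ _ hs hN hT
  refine ⟨d, hd, fun δ h0 hδ w => ?_⟩
  simp only [B_sub_affine]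
  exact h δ h0 hδ ((Matrix.mulVecBilin ℝ ℝ).flip w)

lemma tendstoInMeanSquare_of_error [IsProbabilityMeasure μ] {ι : Type*} [Fintype ι]
    {Y E : ℕ → Ω → ι → ℝ} {l : ι → ℝ} (hY : ∀ t ω, Y t ω = l + E t ω)
    (hm : ∀ t, AEStronglyMeasurable (E t) μ) (hsum : ∑' t, eLpNorm (E t) 2 μ ≠ ∞) :
    TendstoInMeanSquare μ Y l := by
  have hE : ∀ t, MemLp (E t) 2 μ := fun t =>
    ⟨hm t, (ENNReal.ne_top_of_tsum_ne_top hsum t).lt_top⟩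
  have hEp : ∀ t p, MemLp (fun ω => E t ω p) 2 μ := fun t p =>
    (hE t).mono ((continuous_apply p).comp_aestronglyMeasurable (hm t))
      (ae_of_all _ fun ω => norm_le_pi_norm _ p)
  refine ⟨fun t p => ?_, ?_⟩
  · simp only [hY, Pi.add_apply]
    exact (memLp_const (l p)).add (hEp t p)
  · simp only [hY, Pi.add_apply, add_sub_cancel_left]
    -- The norm of `ι → ℝ` is the supremum norm; the factor `Fintype.card ι` passes to the Euclidean
    -- one.
    have h := (tendsto_integral_norm_sq_zero hE
      (ENNReal.tendsto_atTop_zero_of_tsum_ne_top hsum)).const_mul (Fintype.card ι : ℝ)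
    rw [mul_zero] at h
    refine squeeze_zero (fun t => integral_nonneg fun ω => Finset.sum_nonneg fun p _ =>
      sq_nonneg _) (fun t => ?_) h
    rw [← integral_const_mul]
    refine integral_mono (integrable_finsetSum _ fun p _ => (hEp t p).integrable_sq)
      ((hE t).integrable_norm_pow (p := 2) two_ne_zero |>.const_mul _) fun ω => ?_
    calc ∑ p, E t ω p ^ 2 ≤ ∑ _p : ι, ‖E t ω‖ ^ 2 := Finset.sum_le_sum fun p _ => by
          rw [← sq_abs]
          exact pow_le_pow_left₀ (abs_nonneg _) (norm_le_pi_norm (E t ω) p) 2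
      _ = _ := by rw [Finset.sum_const, Finset.card_univ, nsmul_eq_mul]

end Convergence

end BlindCalibration

theorem theorem2 {n : ℕ}
    -- gains and offsets of the sensors
    (α β : Fin n → ℝ) (hα : ∀ i, α i ≠ 0)
    -- the communication digraph (`G.Adj j i`: sensor `j` sends to sensor `i`) and the weights
    (G : Digraph (Fin n)) (γ : Fin n → Fin n → ℝ)
    (hγ_pos : ∀ i j, G.Adj j i → 0 < γ i j)
    (hγ_zero : ∀ i j, ¬ G.Adj j i → γ i j = 0)
    (hG : BlindCalibration.HasSpanningTree G)
    -- the signal: i.i.d. with finite second moment and positive variance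
    {Ω : Type*} [MeasurableSpace Ω] (μ : Measure Ω) [IsProbabilityMeasure μ]
    (x : ℕ → Ω → ℝ) (hx_meas : ∀ t, Measurable (x t))
    (hx_indep : iIndepFun x μ) (hx_ident : ∀ t, IdentDistrib (x t) (x 0) μ μ)
    (hx_sq : MemLp (x 0) 2 μ) (hx_var : 0 < variance (x 0) μ) :
    ∃ π₁ π₂ : Fin n × Fin 2 → ℝ,
      BlindCalibration.IsNormalizedLeftPair (BlindCalibration.Bbar μ α β γ (x 0)) π₁ π₂ ∧
      (∀ π₁' π₂' : Fin n × Fin 2 → ℝ,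
        BlindCalibration.IsNormalizedLeftPair (BlindCalibration.Bbar μ α β γ (x 0)) π₁' π₂' →
          π₁' = π₁ ∧ π₂' = π₂) ∧
      ∃ δ'' : ℝ, 0 < δ'' ∧ ∀ δ : ℝ, 0 < δ → δ ≤ δ'' →
        ∀ ρ₀ ρ_lim : Fin n × Fin 2 → ℝ,
          ρ_lim = (Matrix.vecMulVec (BlindCalibration.i₁ n) π₁ +
            Matrix.vecMulVec (BlindCalibration.i₂ n) π₂) *ᵥ ρ₀ →
          -- convergence with probability one
          (∀ᵐ ω ∂μ, Tendsto (fun t => BlindCalibration.rho α β γ δ ρ₀ (fun s => x s ω) t)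
            atTop (𝓝 ρ_lim)) ∧
          -- convergence in the mean square sense
          (MemLp (x 0) 4 μ →
            BlindCalibration.TendstoInMeanSquare μ
              (fun t ω => BlindCalibration.rho α β γ δ ρ₀ (fun s => x s ω) t) ρ_lim) ∧
          -- all the gains agree in the limit, and so do all the offsets
          (∀ i j : Fin n, ρ_lim (i, 0) = ρ_lim (j, 0) ∧ ρ_lim (i, 1) = ρ_lim (j, 1)) := by
  open BlindCalibration in
  have hG' := hG
  obtain ⟨r, -⟩ := hG'
  have : Nonempty (Fin n) := ⟨r⟩
  have hn : 0 < n := r.pos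
  have hγ := weight_nonneg hγ_pos hγ_zero
  rw [Bbar_eq_meanB hx_sq]
  have hstab0 := hx_var
  rw [variance_eq_sub hx_sq] at hstab0
  have hs : (∫ ω, x 0 ω ∂μ) ^ 2 < ∫ ω, x 0 ω ^ 2 ∂μ := by simpa using hstab0
  have hker := fun v => meanB_ker (v := v) (β := β) hα hγ_pos hγ_zero hG hs
  have hM := fun v c₁ c₂ => meanB_range_inter (α := α) (β := β) (m := ∫ ω, x 0 ω ∂μ)
    (s := ∫ ω, x 0 ω ^ 2 ∂μ) (v := v) (c₁ := c₁) (c₂ := c₂) hn hγ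
  obtain ⟨π₁, π₂, hπ⟩ := exists_isNormalizedLeftPair hM
  refine ⟨π₁, π₂, hπ, fun π₁' π₂' h' => hπ.unique hker hM h', ?_⟩
  have hstab := fun z w => hπ.eigenvector_sub_proj_eq_zero hker
    (fun z w hz hre hw => meanB_eigenvector_eq_zero (α := α) (β := β) hγ hs hz hre hw) (z := z) (w := w)
  have hPB : ∀ ξ, consensusProj π₁ π₂ * B α β γ ξ = 0 := fun ξ => by
    rw [B_eq_meanB, consensusProj, add_mul, Matrix.vecMulVec_mul, Matrix.vecMulVec_mul,
      vecMul_meanB_eq_zero hs hπ.1, vecMul_meanB_eq_zero hs hπ.2.1]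
    simp
  have hBP : ∀ ξ, B α β γ ξ * consensusProj π₁ π₂ = 0 := fun ξ => by
    rw [B_eq_meanB]
    exact mul_consensusProj (meanB_mulVec_i₁ _ _) (meanB_mulVec_i₂ _ _)
  -- The exponent `1`: integrability of `x` and `x²` suffices.
  obtain ⟨d₁, hd₁, hc₁⟩ := exists_step_tsum_error_ne_top hx_meas hx_indep hx_ident le_rfl
    ENNReal.one_ne_top (hx_sq.mono_exponent (by norm_num)) (memLp_one_iff_integrable.2
      hx_sq.integrable_sq) hstab
  obtain ⟨d₂, hd₂, hc₂⟩ : ∃ d > 0, ∀ δ : ℝ, 0 < δ → δ ≤ d → MemLp (x 0) 4 μ →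
      ∀ w : Fin n × Fin 2 → ℝ, (∀ t, AEStronglyMeasurable
        (fun ω => stepProd δ (fun k => B α β γ (x k ω) - consensusProj π₁ π₂) t *ᵥ w) μ) ∧
      ∑' t, eLpNorm (fun ω => stepProd δ (fun k => B α β γ (x k ω) - consensusProj π₁ π₂) t *ᵥ w)
        2 μ ≠ ⊤ := by
    by_cases h4 : MemLp (x 0) 4 μ
    · have h2 : MemLp (fun ω => x 0 ω ^ 2) 2 μ := by
        refine (memLp_two_iff_integrable_sq (f := fun ω => x 0 ω ^ 2) (h4.1.pow 2)).2 ?_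
        have := h4.integrable_norm_pow (p := 4) (by norm_num)
        refine this.congr (ae_of_all _ fun ω => ?_)
        simp only [Real.norm_eq_abs]
        rw [← pow_mul, Even.pow_abs (by decide)]
      obtain ⟨d, hd, h⟩ := exists_step_tsum_error_ne_top hx_meas hx_indep hx_ident one_le_two
        ENNReal.ofNat_ne_top hx_sq h2 hstab
      exact ⟨d, hd, fun δ h0 hδ _ => h δ h0 hδ⟩
    -- The step bound has to be chosen before the fourth moment is assumed; without that moment any
    -- positive value serves.
    · exact ⟨1, one_pos, fun _ _ _ h => absurd h h4⟩
  refine ⟨min d₁ d₂, lt_min hd₁ hd₂, fun δ hδ0 hδ ρ₀ ρ_lim hlim => ?_⟩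
  have hY : ∀ t ω, rho α β γ δ ρ₀ (fun s => x s ω) t = ρ_lim +
      stepProd δ (fun k => B α β γ (x k ω) - consensusProj π₁ π₂) t *ᵥ
        (ρ₀ - consensusProj π₁ π₂ *ᵥ ρ₀) := fun t ω => by
    rw [hlim]
    exact rho_eq hPB hBP hπ.proj_mul_proj δ ρ₀ (fun s => x s ω) t
  refine ⟨?_, fun h4 => ?_, ?_⟩
  · obtain ⟨hm, hsum⟩ := hc₁ δ hδ0 (hδ.trans (min_le_left _ _))
      (ρ₀ - consensusProj π₁ π₂ *ᵥ ρ₀)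
    filter_upwards [ae_tendsto_zero_of_tsum_eLpNorm_one hm hsum] with ω hω
    simp only [hY]
    simpa using hω.const_add ρ_lim
  · obtain ⟨hm, hsum⟩ := hc₂ δ hδ0 (hδ.trans (min_le_right _ _)) h4
      (ρ₀ - consensusProj π₁ π₂ *ᵥ ρ₀)
    exact tendstoInMeanSquare_of_error hY hm hsum
  · intro i j
    rw [hlim]
    simp [Matrix.add_mulVec, Matrix.vecMulVec_mulVec, i₁, i₂]
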